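/- Computation model: a real random access machine (unit-cost arithmetic $+,-,\cdot,/$, floor and comparison on real numbers; natural-number counters and array addresses with unit-cost $+,-$ and comparison; only natural-number constants; no conversion of reals to addresses), programmed by while-programs. (1) There are a program $P$ and a constant $C$ such that for all integers $n\ge 1$ and $k\ge 1$ and every family $\mathcal A=(A_1,\dots,A_n)$ of arithmetic progressions $A_i(j)=x_i+y_i\,j$ ($j=0,1,2,\dots$) with $x_i,y_i\in\mathbb R$, $y_i>0$, the program $P$, given $n,k,x_1,\dots,x_n,y_1,\dots,y_n$, halts after at most $Cn$ steps and outputs the value of the $k$th smallest element of the disjoint-union multiset $U(\mathcal A)=\{A_i(j): 1\le i\le n,\ j\ge 0\}$ (elements counted with multiplicity). (2) Consequently, apportionment by a highest averages method with arithmetic divisors takes $O(n)$ time: there are a program $P'$ and a constant $C'$ such that for all integers $n\ge1$, $k\ge1$, scores $v_1,\dots,v_n>0$ and divisors $d_j=d_0+\delta j$ with $d_0\ge 0$, $\delta>0$ (for example Adams $j$, Jefferson $j+1$, Sainte-Laguë $2j+1$, Imperiali $j+2$, Danish $3j+1$), the program $P'$, given $n,k,d_0,\delta,v_1,\dots,v_n$,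 halts after at most $C'n$ steps and outputs numbers $a_1,\dots,a_n$ of units that form a possible outcome of the following procedure: starting with no units, $k$ units are handed out one at a time, each to an entity $i$ whose current priority $v_i/d_j$ is highest, where $j$ is the number of units that $i$ already holds; ties are broken in some way. Here a zero divisor gives an infinite priority, and entities with infinite priority are compared by their scores $v_i$. -/

import Mathlib

/-! ## Selection in a union of sequences -/

/-- The disjoint-union multiset `U(𝒜)` of a finite family of infinite sequences. As it is infinite,
it is given as an indexed family: one member for each sequence `i` and each position `j`, so
that equal values are counted with multiplicity. -/
def disjointUnion {n : ℕ} (𝒜 : Fin n → ℕ → ℝ) : Fin n × ℕ → ℝ :=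
  fun p => 𝒜 p.1 p.2

/-- `τ` is the value of the `k`th smallest element of the multiset given by the family `f`
(counting from `1`): some `k` members of the multiset are bounded by all the others,
and `τ` is the largest value among those `k`. -/
def IsKthSmallest {ι : Type*} (f : ι → ℝ) (k : ℕ) (τ : ℝ) : Prop :=
  ∃ S : Finset ι, S.card = k ∧ (∃ i ∈ S, f i = τ) ∧ (∀ i ∈ S, f i ≤ τ) ∧ ∀ i ∉ S, τ ≤ f i

/-! ## Highest averages methods -/

/-- The priority `v / d` of an entity with score `v` whose current divisor is `d`. A zero divisor
gives an infinite priority; two infinite priorities are compared by the scores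
(the second component, which plays no role for finite priorities). -/
noncomputable def priority (v d : ℝ) : WithTop ℝ ×ₗ ℝ :=
  if d = 0 then toLex (⊤, v) else toLex (((v / d : ℝ) : WithTop ℝ), 0)

/-- `HighestAverages d v k a`: the highest averages method with divisors `d 0, d 1, …` can give
`a i` units to the entity `i` (with score `v i`), for each `i`, when `k` units in all have been
handed out one at a time, always to an entity whose current priority is highest. An entity
that holds `j` units is on the divisor `d j`. Ties may be broken in any way. -/
inductive HighestAverages {n : ℕ} (d : ℕ → ℝ) (v : Fin n → ℝ) : ℕ → (Fin n → ℕ) → Prop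
  | start : HighestAverages d v 0 (fun _ => 0)
  | give {k : ℕ} {a : Fin n → ℕ} (i : Fin n) (h : HighestAverages d v k a)
      (hi : ∀ i', priority (v i') (d (a i')) ≤ priority (v i) (d (a i))) :
      HighestAverages d v (k + 1) (Function.update a i (a i + 1))

/-! ## A real random access machine

The machine has natural-number registers and arrays, used for counting and addressing, and real
registers and arrays. Register and array names are literals of the program, so a program has
finitely many of each; array cells are addressed by computed natural numbers. Natural numbers
can be added and subtracted; real numbers can be added, subtracted, multiplied, divided and
rounded down. Both can be compared. The only constants are natural numbers, and no real number
can be turned into an address. Every elementary operation costs one unit of time. -/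

namespace RealRAM

/-- The contents of the machine's memory. -/
structure State where
  /-- natural-number registers -/
  nreg : ℕ → ℕ
  /-- real registers -/
  rreg : ℕ → ℝ
  /-- natural-number arrays: the name of the array, then the address in it -/
  narr : ℕ → ℕ → ℕ
  /-- real arrays: the name of the array, then the address in it -/
  rarr : ℕ → ℕ → ℝ

/-- Natural-number expressions. -/
inductive NExpr
  | const (c : ℕ)
  | reg (v : ℕ)
  | load (arr : ℕ) (addr : NExpr)
  | add (e f : NExpr)
  | sub (e f : NExpr)

/-- Value of a natural-number expression (subtraction is truncated at `0`). -/
def NExpr.eval (s : State) : NExpr → ℕ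
  | const c => c
  | reg v => s.nreg v
  | load arr e => s.narr arr (e.eval s)
  | add e f => e.eval s + f.eval s
  | sub e f => e.eval s - f.eval s

/-- Time to evaluate a natural-number expression. -/
def NExpr.cost : NExpr → ℕ
  | const _ => 1
  | reg _ => 1
  | load _ e => e.cost + 1
  | add e f => e.cost + f.cost + 1
  | sub e f => e.cost + f.cost + 1

/-- Real expressions. -/
inductive RExpr
  | const (c : ℕ)
  | reg (v : ℕ)
  | load (arr : ℕ) (addr : NExpr)
  | add (e f : RExpr)
  | sub (e f : RExpr)
  | mul (e f : RExpr)
  | div (e f : RExpr)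
  | floor (e : RExpr)

/-- Value of a real expression (a division by `0` gives `0`). -/
noncomputable def RExpr.eval (s : State) : RExpr → ℝ
  | const c => (c : ℝ)
  | reg v => s.rreg v
  | load arr e => s.rarr arr (e.eval s)
  | add e f => e.eval s + f.eval s
  | sub e f => e.eval s - f.eval s
  | mul e f => e.eval s * f.eval s
  | div e f => e.eval s / f.eval s
  | floor e => ((⌊e.eval s⌋ : ℤ) : ℝ)

/-- Time to evaluate a real expression. -/
def RExpr.cost : RExpr → ℕ
  | const _ => 1
  | reg _ => 1
  | load _ e => e.cost + 1
  | add e f => e.cost + f.cost + 1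
  | sub e f => e.cost + f.cost + 1
  | mul e f => e.cost + f.cost + 1
  | div e f => e.cost + f.cost + 1
  | floor e => e.cost + 1

/-- Tests. -/
inductive Test
  | nle (e f : NExpr)
  | rle (e f : RExpr)
  | not (b : Test)
  | and (b c : Test)

/-- Whether a test succeeds. -/
def Test.holds (s : State) : Test → Prop
  | nle e f => e.eval s ≤ f.eval s
  | rle e f => e.eval s ≤ f.eval s
  | not b => ¬ b.holds s
  | and b c => b.holds s ∧ c.holds s

/-- Time to perform a test. -/
def Test.cost : Test → ℕ
  | nle e f => e.cost + f.cost + 1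
  | rle e f => e.cost + f.cost + 1
  | not b => b.cost + 1
  | and b c => b.cost + c.cost + 1

/-- Programs: assignments to registers and to array cells, sequencing, branching and loops. -/
inductive Program
  | skip
  | nset (v : ℕ) (e : NExpr)
  | rset (v : ℕ) (e : RExpr)
  | nstore (arr : ℕ) (addr : NExpr) (e : NExpr)
  | rstore (arr : ℕ) (addr : NExpr) (e : RExpr)
  | seq (p q : Program)
  | branch (b : Test) (p q : Program)
  | loop (b : Test) (p : Program)

open Function in
/-- `Runs p s s' t`: started in the memory state `s`, the program `p` halts in the state `s'`
after exactly `t` units of time. `branch b p q` is "if `b` then `p` else `q`" and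
`loop b p` is "while `b` do `p`". -/
inductive Runs : Program → State → State → ℕ → Prop
  | skip (s : State) : Runs .skip s s 1
  | nset (s : State) (v : ℕ) (e : NExpr) :
      Runs (.nset v e) s { s with nreg := update s.nreg v (e.eval s) } (e.cost + 1)
  | rset (s : State) (v : ℕ) (e : RExpr) :
      Runs (.rset v e) s { s with rreg := update s.rreg v (e.eval s) } (e.cost + 1)
  | nstore (s : State) (arr : ℕ) (addr : NExpr) (e : NExpr) :
      Runs (.nstore arr addr e) s
        { s with narr := update s.narr arr (update (s.narr arr) (addr.eval s) (e.eval s)) }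
        (addr.cost + e.cost + 1)
  | rstore (s : State) (arr : ℕ) (addr : NExpr) (e : RExpr) :
      Runs (.rstore arr addr e) s
        { s with rarr := update s.rarr arr (update (s.rarr arr) (addr.eval s) (e.eval s)) }
        (addr.cost + e.cost + 1)
  | seq {p q : Program} {s s' s'' : State} {t t' : ℕ} (hp : Runs p s s' t)
      (hq : Runs q s' s'' t') : Runs (.seq p q) s s'' (t + t')
  | branch_true {b : Test} {p q : Program} {s s' : State} {t : ℕ} (hb : b.holds s)
      (hp : Runs p s s' t) : Runs (.branch b p q) s s' (b.cost + 1 + t)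
  | branch_false {b : Test} {p q : Program} {s s' : State} {t : ℕ} (hb : ¬ b.holds s)
      (hq : Runs q s s' t) : Runs (.branch b p q) s s' (b.cost + 1 + t)
  | loop_stop {b : Test} {p : Program} {s : State} (hb : ¬ b.holds s) :
      Runs (.loop b p) s s (b.cost + 1)
  | loop_step {b : Test} {p : Program} {s s' s'' : State} {t t' : ℕ} (hb : b.holds s)
      (hp : Runs p s s' t) (hl : Runs (.loop b p) s' s'' t') :
      Runs (.loop b p) s s'' (b.cost + 1 + t + t')

/-- The array that holds `x 0, …, x (n - 1)` and then zeros. -/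
noncomputable def arrayOf {n : ℕ} (x : Fin n → ℝ) : ℕ → ℝ :=
  fun i => if h : i < n then x ⟨i, h⟩ else 0

/-- The input for selection among the progressions `x i + y i * j`: natural-number register `0`
holds `n`, real register `0` holds `k`, the real arrays `0` and `1` hold the `x i` and the
`y i`. Everything else is `0`. -/
noncomputable def selectionInput {n : ℕ} (x y : Fin n → ℝ) (k : ℕ) : State where
  nreg v := if v = 0 then n else 0
  rreg v := if v = 0 then (k : ℝ) else 0
  narr _ _ := 0
  rarr arr := if arr = 0 then arrayOf x else if arr = 1 then arrayOf y else fun _ => 0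

/-- The input for apportioning `k` units to `n` entities with scores `v i`, with divisors
`d₀ + δ * j`: natural-number register `0` holds `n`, the real registers `0`, `1`, `2` hold
`k`, `d₀`, `δ`, and the real array `0` holds the `v i`. Everything else is `0`. -/
noncomputable def apportionmentInput {n : ℕ} (v : Fin n → ℝ) (d₀ δ : ℝ) (k : ℕ) : State where
  nreg r := if r = 0 then n else 0
  rreg r := if r = 0 then (k : ℝ) else if r = 1 then d₀ else if r = 2 then δ else 0
  narr _ _ := 0
  rarr arr := if arr = 0 then arrayOf v else fun _ => 0

end RealRAM

/-! The number of terms up to `τ` in the progressions `x i + y i * j` differs by at most `n` from the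
piecewise linear function `mass τ = ∑ max 0 ((τ - x i) / y i)`. If `τ'` has the mass
`max 0 (k - n)` and `τ` has the mass `k`, then fewer than `k` terms lie below `τ'`, at least `k` terms
lie below or at `τ`, and at most `2 * n` terms lie between them (`sum_numLT_lt`, `le_sum_numLE`,
`sum_numLE_le_add`). So the `k`-th smallest term is found among these candidates
(`kth_of_search`).

The equations `mass τ = K` and the final selection are instances of one problem: given triples
`(x, a, b)`, each standing for a function that vanishes up to `x` and is `c ↦ a * c + b` beyond it,
find the largest `x` at which the sum of these functions, the `load`, is at most `K`. For the triples
`(x i, 1 / y i, -x i / y i)` the load is the mass, and for the triples `(v, 0, 1)` it counts the `v`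
below a point. Prune and search solves this problem in linear time: compare the load at an
approximate median with `K`, and drop the triples on the wrong side of it; the linear functions of
those that lie below the answer are added up (`SearchInv`, `searchProgram_spec`).

While-programs have no recursion, so the approximate median is not a median of medians. Instead,
the list is cut into groups, and every fourth entry of each group (in the order of size) goes into
a sample; the sample is treated in the same way with groups twice as large, and so on, until it
fits into one group. The ranks in a group are computed by comparing all pairs. Because the samples
shrink by a factor `4` and the groups grow by a factor `2`, both the running times and the relative
errors form convergent geometric series (`SampleInv`, `pivotProgram_spec`).

For apportionment, the priorities `v i / d j` are served in the order of the terms `d j / v i` of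
arithmetic progressions. From the `k`-th smallest term `τ` the entity `i` gets one unit for each of
its terms below `τ`, and the rest goes to terms equal to `τ`. If `d 0 = 0` and `k ≤ n`, all units are
handed out at infinite priority; then the progressions `-v i + v i * j` are used. An allocation in
which no entity would be served before a unit that was handed out is a possible outcome
(`highestAverages_of_priority_le`). -/

/-! ### Running times and frames -/

namespace RealRAM

infixr:60 " ;; " => Program.seq

/-- Total correctness with a time bound: started in `s`, the program `p` halts within `T` units
of time, in a state that satisfies `Q`. -/
def Halts (p : Program) (s : State) (T : ℕ) (Q : State → Prop) : Prop :=
  ∃ s' t, Runs p s s' t ∧ t ≤ T ∧ Q s'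

/-- Whether the program leaves the natural-number register `v` alone. -/
def Program.keepsN (v : ℕ) : Program → Bool
  | .nset v' _ => v != v'
  | .seq p q => p.keepsN v && q.keepsN v
  | .branch _ p q => p.keepsN v && q.keepsN v
  | .loop _ p => p.keepsN v
  | _ => true

/-- Whether the program leaves the real register `v` alone. -/
def Program.keepsR (v : ℕ) : Program → Bool
  | .rset v' _ => v != v'
  | .seq p q => p.keepsR v && q.keepsR v
  | .branch _ p q => p.keepsR v && q.keepsR v
  | .loop _ p => p.keepsR v
  | _ => true

/-- Whether the program leaves the real array `v` alone. -/
def Program.keepsA (v : ℕ) : Program → Bool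
  | .rstore v' _ _ => v != v'
  | .seq p q => p.keepsA v && q.keepsA v
  | .branch _ p q => p.keepsA v && q.keepsA v
  | .loop _ p => p.keepsA v
  | _ => true

/-- The states `s` and `s'` agree on all registers and real arrays to which the text of `p`
never assigns. -/
structure Frame (p : Program) (s s' : State) : Prop where
  n : ∀ v, p.keepsN v = true → s'.nreg v = s.nreg v
  r : ∀ v, p.keepsR v = true → s'.rreg v = s.rreg v
  a : ∀ v, p.keepsA v = true → s'.rarr v = s.rarr v

theorem Frame.refl (p : Program) (s : State) : Frame p s s :=
  ⟨fun _ _ => rfl, fun _ _ => rfl, fun _ _ => rfl⟩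

theorem Frame.trans {p : Program} {s s' s'' : State} (h : Frame p s s') (h' : Frame p s' s'') :
    Frame p s s'' :=
  ⟨fun v hv => (h'.n v hv).trans (h.n v hv), fun v hv => (h'.r v hv).trans (h.r v hv),
    fun v hv => (h'.a v hv).trans (h.a v hv)⟩

theorem Frame.of_keeps {p q : Program} {s s' : State} (h : Frame p s s')
    (hn : ∀ v, q.keepsN v = true → p.keepsN v = true)
    (hr : ∀ v, q.keepsR v = true → p.keepsR v = true)
    (ha : ∀ v, q.keepsA v = true → p.keepsA v = true) : Frame q s s' :=
  ⟨fun v hv => h.n v (hn v hv), fun v hv => h.r v (hr v hv), fun v hv => h.a v (ha v hv)⟩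

theorem Runs.frame {p : Program} {s s' : State} {t : ℕ} (h : Runs p s s' t) : Frame p s s' := by
  induction h with
  | skip s => exact .refl _ _
  | nset s v e =>
    refine ⟨fun w hw => ?_, fun _ _ => rfl, fun _ _ => rfl⟩
    exact Function.update_of_ne (by simpa [Program.keepsN] using hw) _ _
  | rset s v e =>
    refine ⟨fun _ _ => rfl, fun w hw => ?_, fun _ _ => rfl⟩
    exact Function.update_of_ne (by simpa [Program.keepsR] using hw) _ _
  | nstore s arr addr e => exact ⟨fun _ _ => rfl, fun _ _ => rfl, fun _ _ => rfl⟩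
  | rstore s arr addr e =>
    refine ⟨fun _ _ => rfl, fun _ _ => rfl, fun w hw => ?_⟩
    exact Function.update_of_ne (by simpa [Program.keepsA] using hw) _ _
  | seq hp hq ihp ihq =>
    refine (ihp.of_keeps ?_ ?_ ?_).trans (ihq.of_keeps ?_ ?_ ?_) <;>
      intro v hv <;>
      simp only [Program.keepsN, Program.keepsR, Program.keepsA, Bool.and_eq_true] at hv
    exacts [hv.1, hv.1, hv.1, hv.2, hv.2, hv.2]
  | branch_true hb hp ih =>
    refine ih.of_keeps ?_ ?_ ?_ <;>
      intro v hv <;>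
      simp only [Program.keepsN, Program.keepsR, Program.keepsA, Bool.and_eq_true] at hv
    exacts [hv.1, hv.1, hv.1]
  | branch_false hb hp ih =>
    refine ih.of_keeps ?_ ?_ ?_ <;>
      intro v hv <;>
      simp only [Program.keepsN, Program.keepsR, Program.keepsA, Bool.and_eq_true] at hv
    exacts [hv.2, hv.2, hv.2]
  | loop_stop hb => exact .refl _ _
  | loop_step hb hp hl ihp ihl =>
    exact .trans (ihp.of_keeps (fun _ h => h) (fun _ h => h) (fun _ h => h)) ihl

section Rules

variable {p q : Program} {b : Test} {s : State} {T T' : ℕ} {Q Q' : State → Prop}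

theorem Halts.mono (h : Halts p s T Q) (hT : T ≤ T') (hQ : ∀ s', Q s' → Q' s') :
    Halts p s T' Q' := by
  obtain ⟨s', t, hr, ht, hq⟩ := h
  exact ⟨s', t, hr, ht.trans hT, hQ _ hq⟩

theorem Halts.frame (h : Halts p s T Q) : Halts p s T (fun s' => Frame p s s' ∧ Q s') := by
  obtain ⟨s', t, hr, ht, hq⟩ := h
  exact ⟨s', t, hr, ht, hr.frame, hq⟩

/-- Sequencing. What the first part leaves alone need not be repeated in its postcondition. -/
theorem Halts.seq (hp : Halts p s T Q') (hq : ∀ s', Frame p s s' → Q' s' → Halts q s' T' Q) :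
    Halts (p ;; q) s (T + T') Q := by
  obtain ⟨s', t, hr, ht, hQ⟩ := hp
  obtain ⟨s'', t', hr', ht', hQ'⟩ := hq s' hr.frame hQ
  exact ⟨s'', t + t', .seq hr hr', by omega, hQ'⟩

/-- A loop that keeps the invariant `I`, where `Φ` pays for each round, test included. As every
round takes time, this also shows that the loop stops. -/
theorem Halts.loop (I : State → Prop) (Φ : State → ℕ) (hs : I s)
    (step : ∀ s', Frame (.loop b p) s s' → I s' → b.holds s' →
      ∃ T, Halts p s' T (fun s'' => I s'' ∧ Φ s'' + T + b.cost + 1 ≤ Φ s')) :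
    Halts (.loop b p) s (Φ s + b.cost + 1) (fun s' => I s' ∧ ¬ b.holds s') := by
  suffices H : ∀ N s', Frame (.loop b p) s s' → I s' → Φ s' ≤ N →
      Halts (.loop b p) s' (Φ s' + b.cost + 1) (fun s' => I s' ∧ ¬ b.holds s') from
    H _ s (.refl _ _) hs le_rfl
  intro N
  induction N with
  | zero =>
    intro s' hF hI hN
    by_cases hb : b.holds s'
    · obtain ⟨T, s'', t, -, -, -, h⟩ := step s' hF hI hb
      omega
    · exact ⟨s', _, Runs.loop_stop hb, by omega, hI, hb⟩
  | succ N ih =>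
    intro s' hF hI hN
    by_cases hb : b.holds s'
    · obtain ⟨T, s'', t, hr, ht, hI'', h⟩ := step s' hF hI hb
      have hF' : Frame (.loop b p) s' s'' :=
        hr.frame.of_keeps (fun _ h => h) (fun _ h => h) (fun _ h => h)
      obtain ⟨s₃, t', hr', ht', hQ⟩ := ih s'' (hF.trans hF') hI'' (by omega)
      exact ⟨s₃, _, .loop_step hb hr hr', by omega, hQ⟩
    · exact ⟨s', _, Runs.loop_stop hb, by omega, hI, hb⟩

end Rules

open Classical in
/-- The effect of a loop-free program (loops are ignored). -/
noncomputable def Program.exec (s : State) : Program → State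
  | .skip => s
  | .nset v e => { s with nreg := Function.update s.nreg v (e.eval s) }
  | .rset v e => { s with rreg := Function.update s.rreg v (e.eval s) }
  | .nstore arr addr e =>
    { s with
      narr := Function.update s.narr arr (Function.update (s.narr arr) (addr.eval s) (e.eval s)) }
  | .rstore arr addr e =>
    { s with
      rarr := Function.update s.rarr arr (Function.update (s.rarr arr) (addr.eval s) (e.eval s)) }
  | .seq p q => q.exec (p.exec s)
  | .branch b p q => if b.holds s then p.exec s else q.exec s
  | .loop _ _ => s

/-- A bound for the running time of a loop-free program. -/
def Program.time : Program → ℕ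
  | .skip => 1
  | .nset _ e => e.cost + 1
  | .rset _ e => e.cost + 1
  | .nstore _ addr e => addr.cost + e.cost + 1
  | .rstore _ addr e => addr.cost + e.cost + 1
  | .seq p q => p.time + q.time
  | .branch b p q => b.cost + 1 + max p.time q.time
  | .loop _ _ => 0

/-- Whether the program has no loops. -/
def Program.loopFree : Program → Bool
  | .seq p q => p.loopFree && q.loopFree
  | .branch _ p q => p.loopFree && q.loopFree
  | .loop _ _ => false
  | _ => true

theorem exists_runs_exec (p : Program) (hp : p.loopFree = true) (s : State) :
    ∃ t ≤ p.time, Runs p s (p.exec s) t := by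
  induction p generalizing s with
  | skip => exact ⟨_, le_rfl, .skip s⟩
  | nset v e => exact ⟨_, le_rfl, .nset s v e⟩
  | rset v e => exact ⟨_, le_rfl, .rset s v e⟩
  | nstore arr addr e => exact ⟨_, le_rfl, .nstore s arr addr e⟩
  | rstore arr addr e => exact ⟨_, le_rfl, .rstore s arr addr e⟩
  | seq p q ihp ihq =>
    simp only [Program.loopFree, Bool.and_eq_true] at hp
    obtain ⟨t, ht, hr⟩ := ihp hp.1 s
    obtain ⟨t', ht', hr'⟩ := ihq hp.2 (p.exec s)
    exact ⟨t + t', add_le_add ht ht', .seq hr hr'⟩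
  | branch b p q ihp ihq =>
    simp only [Program.loopFree, Bool.and_eq_true] at hp
    by_cases hb : b.holds s
    · obtain ⟨t, ht, hr⟩ := ihp hp.1 s
      refine ⟨b.cost + 1 + t, ?_, ?_⟩
      · simp only [Program.time]; omega
      · simpa only [Program.exec, if_pos hb] using Runs.branch_true hb hr
    · obtain ⟨t, ht, hr⟩ := ihq hp.2 s
      refine ⟨b.cost + 1 + t, ?_, ?_⟩
      · simp only [Program.time]; omega
      · simpa only [Program.exec, if_neg hb] using Runs.branch_false hb hr
  | loop b p ih => simp [Program.loopFree] at hp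

theorem Halts.of_loopFree {p : Program} {s : State} {T : ℕ} {Q : State → Prop}
    (hp : p.loopFree = true) (hT : p.time ≤ T) (hQ : Q (p.exec s)) : Halts p s T Q := by
  obtain ⟨t, ht, hr⟩ := exists_runs_exec p hp s
  exact ⟨_, t, hr, ht.trans hT, hQ⟩

theorem Halts.exec_seq {p q : Program} {s : State} {T : ℕ} {Q : State → Prop}
    (hp : p.loopFree = true) (hq : Halts q (p.exec s) T Q) : Halts (p ;; q) s (p.time + T) Q :=
  Halts.seq (Q' := fun s' => s' = p.exec s) (Halts.of_loopFree hp le_rfl rfl)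
    fun _ _ h => h ▸ hq

attribute [simp] Program.exec Program.time NExpr.eval RExpr.eval Test.holds NExpr.cost RExpr.cost
  Test.cost

/-- "While `v < u`, do `p` and increment `v`", for natural-number registers `v` and `u`. -/
def Program.forLoop (v u : ℕ) (p : Program) : Program :=
  .loop (.nle (.add (.reg v) (.const 1)) (.reg u)) (p ;; .nset v (.add (.reg v) (.const 1)))

/-- The invariant rule for counting loops; `T i` bounds the time of the round for `i`. -/
theorem Halts.forLoop {v u : ℕ} {p : Program} {s : State} {a c : ℕ} (I : ℕ → State → Prop)
    (T : ℕ → ℕ) (hpv : p.keepsN v = true) (hpu : p.keepsN u = true) (huv : v ≠ u)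
    (ha : s.nreg v = a) (hc : s.nreg u = c) (hac : a ≤ c) (hs : I a s)
    (step : ∀ i s', a ≤ i → i < c → Frame (Program.forLoop v u p) s s' → s'.nreg v = i → I i s' →
      Halts p s' (T i)
        (fun s'' => I (i + 1) { s'' with nreg := Function.update s''.nreg v (i + 1) })) :
    Halts (Program.forLoop v u p) s ((∑ i ∈ Finset.Ico a c, (T i + 10)) + 6) (I c) := by
  have h := Halts.loop (b := .nle (.add (.reg v) (.const 1)) (.reg u))
    (p := p ;; .nset v (.add (.reg v) (.const 1))) (s := s)
    (fun s' => a ≤ s'.nreg v ∧ s'.nreg v ≤ c ∧ s'.nreg u = c ∧ I (s'.nreg v) s')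
    (fun s' => ∑ i ∈ Finset.Ico (s'.nreg v) c, (T i + 10))
    ⟨ha.ge, by omega, hc, by rwa [ha]⟩ ?_
  · refine h.mono (by simp [ha, Test.cost, NExpr.cost]) ?_
    rintro s' ⟨⟨_, h1, h2, h3⟩, h4⟩
    simp only [Test.holds, NExpr.eval] at h4
    rwa [show s'.nreg v = c by omega] at h3
  · rintro s' hF ⟨h0, h1, h2, h3⟩ hb
    simp only [Test.holds, NExpr.eval] at hb
    refine ⟨_, Halts.seq (step _ s' h0 (by omega) hF rfl h3) fun s'' hF' h'' =>
      Halts.of_loopFree rfl le_rfl ?_⟩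
    have hv : s''.nreg v = s'.nreg v := hF'.n v hpv
    have hu : s''.nreg u = s'.nreg u := hF'.n u hpu
    simp only [Program.exec, NExpr.eval, Function.update_self, Function.update_of_ne huv.symm]
    refine ⟨⟨by omega, by omega, by omega, by rwa [hv]⟩, ?_⟩
    rw [hv, Finset.sum_eq_sum_Ico_succ_bot (show s'.nreg v < c by omega)]
    simp only [Program.time, NExpr.cost, Test.cost]
    omega

/-- The invariant rule for counting loops, all of whose rounds have the same time bound. -/
theorem Halts.forLoop_const {v u : ℕ} {p : Program} {s : State} {a c : ℕ}
    (I : ℕ → State → Prop) (T : ℕ) (hpv : p.keepsN v = true) (hpu : p.keepsN u = true)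
    (huv : v ≠ u) (ha : s.nreg v = a) (hc : s.nreg u = c) (hac : a ≤ c) (hs : I a s)
    (step : ∀ i s', a ≤ i → i < c → Frame (Program.forLoop v u p) s s' → s'.nreg v = i → I i s' →
      Halts p s' T
        (fun s'' => I (i + 1) { s'' with nreg := Function.update s''.nreg v (i + 1) })) :
    Halts (Program.forLoop v u p) s ((c - a) * (T + 10) + 6) (I c) :=
  (Halts.forLoop I (fun _ => T) hpv hpu huv ha hc hac hs step).mono (by simp) fun _ h => h

end RealRAM

/-! ### Counting and ranks -/

section Counting

open Finset Classical

/-- The number of `i` with `a ≤ i < b` for which `P i` holds. -/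
noncomputable def cardIn (P : ℕ → Prop) (a b : ℕ) : ℕ :=
  #{i ∈ Ico a b | P i}

/-- The number of positions `i` with `a ≤ i < b` at which `f` has a value that satisfies `q`. -/
noncomputable def countIn (q : ℝ → Prop) (f : ℕ → ℝ) (a b : ℕ) : ℕ :=
  cardIn (fun i => q (f i)) a b

/-- The rank, counted from `0`, of the entry at `i` among the entries at the positions
`b, …, e - 1`; equal entries are ordered by position. -/
noncomputable def rankIn (f : ℕ → ℝ) (b e i : ℕ) : ℕ :=
  cardIn (fun j => f j < f i ∨ f j ≤ f i ∧ j < i) b e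

theorem cardIn_congr {P P' : ℕ → Prop} {a b : ℕ} (h : ∀ i, a ≤ i → i < b → (P i ↔ P' i)) :
    cardIn P a b = cardIn P' a b := by
  unfold cardIn
  congr 1
  refine filter_congr fun i hi => ?_
  rw [mem_Ico] at hi
  exact h i hi.1 hi.2

theorem cardIn_self (P : ℕ → Prop) (a : ℕ) : cardIn P a a = 0 := by
  simp [cardIn]

theorem cardIn_succ {P : ℕ → Prop} {a b : ℕ} (h : a ≤ b) :
    cardIn P a (b + 1) = cardIn P a b + if P b then 1 else 0 := by
  unfold cardIn
  rw [← insert_Ico_right_eq_Ico_add_one h, filter_insert]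
  split_ifs <;> simp

theorem countIn_congr {q : ℝ → Prop} {f g : ℕ → ℝ} {a b : ℕ}
    (h : ∀ i, a ≤ i → i < b → f i = g i) : countIn q f a b = countIn q g a b :=
  cardIn_congr fun i hi hi' => by rw [h i hi hi']

theorem countIn_add {q : ℝ → Prop} {f : ℕ → ℝ} {a b c : ℕ} (hab : a ≤ b) (hbc : b ≤ c) :
    countIn q f a b + countIn q f b c = countIn q f a c := by
  unfold countIn cardIn
  rw [← Ico_union_Ico_eq_Ico hab hbc, filter_union, card_union_of_disjoint]
  exact disjoint_filter_filter (Ico_disjoint_Ico_consecutive a b c)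

theorem countIn_true (f : ℕ → ℝ) (a b : ℕ) : countIn (fun _ => True) f a b = b - a := by
  simp [countIn, cardIn]

theorem countIn_add_countIn_not (q : ℝ → Prop) (f : ℕ → ℝ) (a b : ℕ) :
    countIn q f a b + countIn (fun x => ¬ q x) f a b = b - a := by
  unfold countIn cardIn
  rw [card_filter_add_card_filter_not]
  simp

theorem rankIn_lt_rankIn {f : ℕ → ℝ} {b e i j : ℕ} (hi : i ∈ Ico b e)
    (h : f i < f j ∨ f i ≤ f j ∧ i < j) : rankIn f b e i < rankIn f b e j := by
  unfold rankIn cardIn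
  refine card_lt_card ((ssubset_iff_of_subset fun k hk => ?_).2 ⟨i, ?_, ?_⟩)
  · simp only [mem_filter] at hk ⊢
    refine ⟨hk.1, ?_⟩
    rcases hk.2 with h1 | ⟨h1, h1'⟩ <;> rcases h with h2 | ⟨h2, h2'⟩
    · exact .inl (h1.trans h2)
    · exact .inl (h1.trans_le h2)
    · exact .inl (h1.trans_lt h2)
    · exact .inr ⟨h1.trans h2, h1'.trans h2'⟩
  · simp [h, mem_Ico.1 hi]
  · simp

theorem rankIn_injOn (f : ℕ → ℝ) (b e : ℕ) :
    Set.InjOn (rankIn f b e) (Ico b e : Finset ℕ) := by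
  intro i hi j hj h
  by_contra hij
  have key : (f i < f j ∨ f i ≤ f j ∧ i < j) ∨ (f j < f i ∨ f j ≤ f i ∧ j < i) := by
    rcases lt_trichotomy (f i) (f j) with h | h | h
    · exact .inl (.inl h)
    · rcases lt_or_gt_of_ne hij with h' | h'
      · exact .inl (.inr ⟨h.le, h'⟩)
      · exact .inr (.inr ⟨h.ge, h'⟩)
    · exact .inr (.inl h)
  rcases key with h' | h'
  · exact (rankIn_lt_rankIn hi h').ne h
  · exact (rankIn_lt_rankIn hj h').ne h.symm

/-- The entries that belong to a lower set have the smallest ranks. -/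
theorem image_rankIn {q : ℝ → Prop} (hq : Antitone q) (f : ℕ → ℝ) (b e : ℕ) :
    ({i ∈ Ico b e | q (f i)} : Finset ℕ).image (rankIn f b e) = range (countIn q f b e) := by
  refine eq_of_subset_of_card_le (fun r hr => ?_) ?_
  · obtain ⟨i, hi, rfl⟩ := mem_image.1 hr
    rw [mem_filter] at hi
    rw [mem_range]
    unfold rankIn countIn cardIn
    refine card_lt_card ((ssubset_iff_of_subset fun k hk => ?_).2 ⟨i, ?_, ?_⟩)
    · simp only [mem_filter] at hk ⊢
      refine ⟨hk.1, hq ?_ hi.2⟩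
      rcases hk.2 with h | ⟨h, -⟩
      exacts [h.le, h]
    · rwa [mem_filter]
    · simp
  · rw [card_range, card_image_of_injOn]
    · rfl
    · exact (rankIn_injOn f b e).mono (by simp only [coe_subset]; exact filter_subset _ _)

theorem lt_countIn_iff {q : ℝ → Prop} (hq : Antitone q) {f : ℕ → ℝ} {b e r : ℕ} :
    r < countIn q f b e ↔ ∃ i ∈ Ico b e, q (f i) ∧ rankIn f b e i = r := by
  rw [← mem_range, ← image_rankIn hq]
  simp [and_assoc]

theorem card_filter_mod_four (n : ℕ) : #{r ∈ range n | r % 4 = 3} = n / 4 := by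
  induction n with
  | zero => simp
  | succ n ih =>
    rw [range_add_one, filter_insert]
    split_ifs
    · rw [card_insert_of_notMem (by simp), ih]
      omega
    · rw [ih]
      omega

/-- Keeping every fourth entry, in the order of size, divides the counts of lower sets by four. -/
theorem cardIn_rankIn_mod_four {q : ℝ → Prop} (hq : Antitone q) (f : ℕ → ℝ) (b e : ℕ) :
    cardIn (fun i => rankIn f b e i % 4 = 3 ∧ q (f i)) b e = countIn q f b e / 4 := by
  rw [← card_filter_mod_four, ← image_rankIn hq f b e, filter_image, card_image_of_injOn]
  · unfold cardIn
    congr 1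
    ext i
    simp only [mem_filter]
    tauto
  · refine (rankIn_injOn f b e).mono ?_
    intro i hi
    simp only [coe_filter, mem_filter, Set.mem_ofPred_eq] at hi
    exact mem_coe.2 hi.1.1

theorem exists_rankIn_eq (f : ℕ → ℝ) {b e r : ℕ} (hr : r < e - b) :
    ∃ i ∈ Ico b e, rankIn f b e i = r := by
  rw [← countIn_true f b e, lt_countIn_iff fun _ _ _ h => h] at hr
  obtain ⟨i, hi, -, h⟩ := hr
  exact ⟨i, hi, h⟩

theorem rankIn_lt_countIn_le (f : ℕ → ℝ) {b e i : ℕ} (hi : i ∈ Ico b e) :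
    rankIn f b e i < countIn (· ≤ f i) f b e :=
  (lt_countIn_iff fun _ _ h h' => h.trans h').2 ⟨i, hi, le_rfl, rfl⟩

theorem countIn_lt_le_rankIn (f : ℕ → ℝ) (b e i : ℕ) :
    countIn (· < f i) f b e ≤ rankIn f b e i := by
  unfold rankIn countIn cardIn
  refine card_le_card fun j hj => ?_
  simp only [mem_filter] at hj ⊢
  exact ⟨hj.1, .inl hj.2⟩

theorem rankIn_congr {f g : ℕ → ℝ} {b e i : ℕ} (h : ∀ j, b ≤ j → j < e → f j = g j)
    (hi : b ≤ i) (hi' : i < e) : rankIn f b e i = rankIn g b e i :=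
  cardIn_congr fun j hj hj' => by rw [h j hj hj', h i hi hi']

theorem countIn_update_succ (q : ℝ → Prop) (f : ℕ → ℝ) {a b : ℕ} (hab : a ≤ b) (z : ℝ) :
    countIn q (Function.update f b z) a (b + 1) =
      countIn q f a b + if q z then 1 else 0 := by
  rw [countIn, cardIn_succ hab, Function.update_self]
  congr 1
  exact cardIn_congr fun i _ hi => by rw [Function.update_of_ne hi.ne]

end Counting

namespace RealRAM

/-! ### An approximate median -/

theorem three_le_sub_floor_iff (r : ℕ) : (3 : ℝ) ≤ r - 4 * ((⌊(r : ℝ) / 4⌋ : ℤ) : ℝ) ↔ r % 4 = 3 := by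
  have h : ⌊(r : ℝ) / 4⌋ = ((r / 4 : ℕ) : ℤ) := by
    have := Int.floor_div_natCast (r : ℝ) 4
    push_cast at this ⊢
    rw [this, Int.floor_natCast]
  rw [h]
  have h2 := Nat.div_add_mod r 4
  have h3 : (r : ℝ) - 4 * (((r / 4 : ℕ) : ℤ) : ℝ) = ((r % 4 : ℕ) : ℝ) := by
    have h4 : (r : ℝ) = ((4 * (r / 4) + r % 4 : ℕ) : ℝ) := by rw [h2]
    rw [Nat.cast_add, Nat.cast_mul] at h4
    rw [Int.cast_natCast, sub_eq_iff_eq_add']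
    exact h4
  rw [h3, show (3 : ℝ) = ((3 : ℕ) : ℝ) by norm_num, Nat.cast_le]
  omega

/-- Puts the rank of the entry at `nreg 2` among the entries of array `2` at the positions from
`nreg 7` up to, but without, `nreg 8` into the registers `nreg 10` and `rreg 6`. -/
def rankProgram : Program :=
  (.nset 3 (.reg 7) ;; .nset 10 (.const 0) ;; .rset 6 (.const 0)) ;;
  .forLoop 3 8
    (.branch
      (.and (.rle (.load 2 (.reg 2)) (.load 2 (.reg 3)))
        (.not (.and (.rle (.load 2 (.reg 3)) (.load 2 (.reg 2)))
          (.nle (.add (.reg 3) (.const 1)) (.reg 2)))))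
      .skip
      (.nset 10 (.add (.reg 10) (.const 1)) ;; .rset 6 (.add (.reg 6) (.const 1))))

theorem rankProgram_spec (s : State) (h : s.nreg 7 ≤ s.nreg 8) :
    Halts rankProgram s ((s.nreg 8 - s.nreg 7) * 40 + 20) (fun s' =>
      s'.nreg 10 = rankIn (s.rarr 2) (s.nreg 7) (s.nreg 8) (s.nreg 2) ∧
      s'.rreg 6 = rankIn (s.rarr 2) (s.nreg 7) (s.nreg 8) (s.nreg 2)) := by
  refine Halts.mono (Halts.exec_seq rfl <|
    Halts.forLoop_const (a := s.nreg 7) (c := s.nreg 8) (fun j s' =>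
      s'.nreg 10 = cardIn (fun j => s.rarr 2 j < s.rarr 2 (s.nreg 2) ∨
        s.rarr 2 j ≤ s.rarr 2 (s.nreg 2) ∧ j < s.nreg 2) (s.nreg 7) j ∧
      s'.rreg 6 = cardIn (fun j => s.rarr 2 j < s.rarr 2 (s.nreg 2) ∨
        s.rarr 2 j ≤ s.rarr 2 (s.nreg 2) ∧ j < s.nreg 2) (s.nreg 7) j)
      30 rfl rfl (by decide) ?_ ?_ h ?_ ?_) ?_ fun _ h => h
  · simp
  · simp
  · simp [cardIn_self]
  · intro j s' hj _ hF hj3 hI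
    have e1 : s'.rarr 2 = s.rarr 2 := by
      rw [hF.a 2 rfl]; simp
    have e2 : s'.nreg 2 = s.nreg 2 := by
      rw [hF.n 2 rfl]; simp
    refine Halts.of_loopFree rfl (by decide) ?_
    simp only [cardIn_succ hj]
    by_cases hc : s.rarr 2 j < s.rarr 2 (s.nreg 2) ∨
        s.rarr 2 j ≤ s.rarr 2 (s.nreg 2) ∧ j < s.nreg 2
    · have : ¬ (s.rarr 2 (s.nreg 2) ≤ s.rarr 2 j ∧
          ¬ (s.rarr 2 j ≤ s.rarr 2 (s.nreg 2) ∧ j + 1 ≤ s.nreg 2)) := by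
        rintro ⟨h1, h2⟩
        rcases hc with h | h
        · exact h.not_ge h1
        · exact h2 h
      simp only [Program.exec, Test.holds, RExpr.eval, NExpr.eval, e1, e2, hj3, if_pos hc,
        if_neg this]
      simp [hI]
    · have : s.rarr 2 (s.nreg 2) ≤ s.rarr 2 j ∧
          ¬ (s.rarr 2 j ≤ s.rarr 2 (s.nreg 2) ∧ j + 1 ≤ s.nreg 2) := by
        rw [not_or] at hc
        exact ⟨not_lt.1 hc.1, hc.2⟩
      simp only [Program.exec, Test.holds, RExpr.eval, NExpr.eval, e1, e2, hj3, if_neg hc,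
        if_pos this]
      simp [hI]
  · simp
    omega

end RealRAM

namespace RealRAM

/-- Appends to array `2`, at `nreg 9`, those entries between the positions `nreg 7` and `nreg 8`
whose rank among these entries is `3` modulo `4`. -/
def groupProgram : Program :=
  .nset 2 (.reg 7) ;;
  .forLoop 2 8 (rankProgram ;;
    .branch (.rle (.const 3) (.sub (.reg 6) (.mul (.const 4) (.floor (.div (.reg 6) (.const 4))))))
      (.rstore 2 (.reg 9) (.load 2 (.reg 2)) ;; .nset 9 (.add (.reg 9) (.const 1)))
      .skip)

theorem groupProgram_spec {s : State} {b e w : ℕ} (hb : s.nreg 7 = b) (he : s.nreg 8 = e)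
    (hw : s.nreg 9 = w) (hbe : b ≤ e) (hew : e ≤ w) :
    Halts groupProgram s ((e - b) * ((e - b) * 40 + 80) + 20) (fun s' =>
      w ≤ s'.nreg 9 ∧ (∀ i < w, s'.rarr 2 i = s.rarr 2 i) ∧
      ∀ q, countIn q (s'.rarr 2) w (s'.nreg 9) =
        cardIn (fun i => rankIn (s.rarr 2) b e i % 4 = 3 ∧ q (s.rarr 2 i)) b e) := by
  refine Halts.mono (Halts.exec_seq rfl <|
    Halts.forLoop_const (a := b) (c := e) (fun i s' =>
      w ≤ s'.nreg 9 ∧ (∀ i < w, s'.rarr 2 i = s.rarr 2 i) ∧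
      ∀ q, countIn q (s'.rarr 2) w (s'.nreg 9) =
        cardIn (fun i => rankIn (s.rarr 2) b e i % 4 = 3 ∧ q (s.rarr 2 i)) b i)
      ((e - b) * 40 + 70) rfl rfl (by decide) ?_ ?_ hbe ?_ ?_) ?_ fun _ h => h
  · simp [hb]
  · simp [he]
  · simp [hw, cardIn_self, countIn]
  · rintro i s' hi hie hF hi2 ⟨h1, h2, h3⟩
    have e7 : s'.nreg 7 = b := by rw [hF.n 7 rfl]; simp [hb]
    have e8 : s'.nreg 8 = e := by rw [hF.n 8 rfl]; simp [he]
    refine Halts.mono ((rankProgram_spec s' (by omega)).seq (T' := 50) fun s'' hF' hr => ?_) ?_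
      fun _ h => h
    · refine Halts.of_loopFree rfl (by decide) ?_
      have ea : s''.rarr 2 = s'.rarr 2 := hF'.a 2 rfl
      have e9 : s''.nreg 9 = s'.nreg 9 := hF'.n 9 rfl
      have e2 : s''.nreg 2 = i := by rw [hF'.n 2 rfl, hi2]
      have hr' : rankIn (s'.rarr 2) b e i = rankIn (s.rarr 2) b e i :=
        rankIn_congr (fun j _ hj => h2 j (by omega)) hi hie
      have hrank : s''.rreg 6 = rankIn (s.rarr 2) b e i := by
        rw [hr.2, e7, e8, hi2, hr']
      have hval : s'.rarr 2 i = s.rarr 2 i := h2 i (by omega)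
      by_cases hc : rankIn (s.rarr 2) b e i % 4 = 3
      · have := (three_le_sub_floor_iff _).2 hc
        simp [hrank, this, ea, e9, e2, hval]
        refine ⟨by omega, fun j hj => ?_, fun q => ?_⟩
        · rw [Function.update_of_ne (by omega), h2 j hj]
        · rw [countIn_update_succ q _ h1, h3, cardIn_succ hi]
          by_cases hq : q (s.rarr 2 i) <;> simp [hc, hq]
      · have := mt (three_le_sub_floor_iff _).1 hc
        simp [hrank, this, ea, e9, hc, h1, h3, cardIn_succ hi]
        exact h2
    · rw [e7, e8]
  · simp
    nlinarith

/-- One round of sampling: cuts the entries of array `2` between the positions `nreg 4` and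
`nreg 5` into groups of `nreg 6` entries (the last one may be smaller) and appends the sample of
each group at `nreg 5`. The end of the samples is left in `nreg 9`. -/
def levelProgram : Program :=
  (.nset 7 (.reg 4) ;; .nset 9 (.reg 5)) ;;
  .loop (.nle (.add (.reg 7) (.const 1)) (.reg 5))
    ((.nset 8 (.add (.reg 7) (.reg 6)) ;;
      .branch (.nle (.reg 5) (.reg 8)) (.nset 8 (.reg 5)) .skip) ;;
    groupProgram ;; .nset 7 (.reg 8))

theorem levelProgram_spec {s : State} {lo hi g : ℕ} (hlo : s.nreg 4 = lo) (hhi : s.nreg 5 = hi)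
    (hg : s.nreg 6 = g) (hg0 : 0 < g) (hlh : lo ≤ hi) :
    Halts levelProgram s ((hi - lo) * g * 200 + 20) (fun s' =>
      hi ≤ s'.nreg 9 ∧ (∀ i < hi, s'.rarr 2 i = s.rarr 2 i) ∧
      ∃ t, t * g ≤ hi - lo + g ∧ ∀ q, Antitone q →
        4 * countIn q (s'.rarr 2) hi (s'.nreg 9) ≤ countIn q (s.rarr 2) lo hi ∧
        countIn q (s.rarr 2) lo hi ≤ 4 * countIn q (s'.rarr 2) hi (s'.nreg 9) + 3 * t) := by
  refine Halts.mono (Halts.exec_seq rfl <| Halts.frame <| Halts.loop (fun s' =>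
      lo ≤ s'.nreg 7 ∧ s'.nreg 7 ≤ hi ∧ hi ≤ s'.nreg 9 ∧ (∀ i < hi, s'.rarr 2 i = s.rarr 2 i) ∧
      ∃ t, t * g ≤ s'.nreg 7 - lo + g ∧ (s'.nreg 7 < hi → t * g = s'.nreg 7 - lo) ∧
        ∀ q, Antitone q →
        4 * countIn q (s'.rarr 2) hi (s'.nreg 9) ≤ countIn q (s.rarr 2) lo (s'.nreg 7) ∧
        countIn q (s.rarr 2) lo (s'.nreg 7) ≤
          4 * countIn q (s'.rarr 2) hi (s'.nreg 9) + 3 * t)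
    (fun s' => (hi - s'.nreg 7) * g * 200) ?_ ?_) ?_ ?_
  · simp only [Program.exec, NExpr.eval]
    simp [hlo, hhi, hlh, countIn, cardIn_self]
    exact ⟨0, by simp⟩
  · rintro s' hF ⟨h1, h2, h3, h4, t, ht, ht', hq⟩ hlt
    have e5 : s'.nreg 5 = hi := by rw [hF.n 5 rfl]; simp [hhi]
    have e6 : s'.nreg 6 = g := by rw [hF.n 6 rfl]; simp [hg]
    simp only [Test.holds, NExpr.eval, e5] at hlt
    set b := s'.nreg 7 with hb
    set w := s'.nreg 9 with hw
    set s1 := Program.exec s' (.nset 8 (.add (.reg 7) (.reg 6)) ;;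
      .branch (.nle (.reg 5) (.reg 8)) (.nset 8 (.reg 5)) .skip) with hs1
    have hs18 : s1.nreg 8 = min (b + g) hi := by
      rw [hs1]
      by_cases hc : hi ≤ b + g
      · simp [e5, e6, ← hb, hc]
      · simp [e5, e6, ← hb, hc]
        omega
    have hs17 : s1.nreg 7 = b := by
      rw [hs1]
      by_cases hc : hi ≤ b + g
      · simp [e5, e6, ← hb, hc]
      · simp [e5, e6, ← hb, hc]
    have hs19 : s1.nreg 9 = w := by
      rw [hs1]
      by_cases hc : hi ≤ b + g
      · simp [e5, e6, ← hb, hc, ← hw]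
      · simp [e5, e6, ← hb, hc, ← hw]
    have hs1a : s1.rarr 2 = s'.rarr 2 := by
      rw [hs1]
      by_cases hc : hi ≤ b + g
      · simp [e5, e6, ← hb, hc]
      · simp [e5, e6, ← hb, hc]
    obtain ⟨e, he⟩ : ∃ e, e = min (b + g) hi := ⟨_, rfl⟩
    rw [← he] at hs18
    refine ⟨_, Halts.exec_seq rfl <| Halts.seq
      (groupProgram_spec hs17 hs18 hs19 (by omega) (by omega))
      fun s2 hF2 ⟨k1, k2, k3⟩ => Halts.of_loopFree rfl le_rfl ?_⟩
    have e28 : s2.nreg 8 = e := by rw [hF2.n 8 rfl, hs18]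
    have hagree : ∀ i < hi, s2.rarr 2 i = s.rarr 2 i := fun i hi' => by
      rw [k2 i (by omega), hs1a, h4 i hi']
    have hcount : ∀ q, Antitone q → countIn q (s2.rarr 2) hi (s2.nreg 9) =
        countIn q (s'.rarr 2) hi w + countIn q (s.rarr 2) b e / 4 := by
      intro q hq
      rw [← countIn_add h3 k1, k3, cardIn_rankIn_mod_four hq, hs1a]
      congr 1
      · exact countIn_congr fun i _ hi' => by rw [k2 i hi', hs1a]
      · congr 1
        exact countIn_congr fun i _ hi' => h4 i (by omega)
    simp only [Program.exec, NExpr.eval, Function.update_self, e28]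
    refine ⟨⟨by omega, by omega, ?_, hagree, t + 1, ?_, ?_, fun q hq' => ?_⟩, ?_⟩
    · simp; omega
    · have := ht' (by omega)
      rw [Nat.add_mul, this]
      omega
    · intro hlt'
      have := ht' (by omega)
      rw [Nat.add_mul, this]
      omega
    · have := hq q hq'
      have h9 := hcount q hq'
      have hadd := countIn_add (q := q) (f := s.rarr 2) h1 (show b ≤ e by omega)
      rw [Function.update_of_ne (by decide), h9, ← hadd]
      omega
    · obtain ⟨L, hL⟩ : ∃ L, L = e - b := ⟨_, rfl⟩
      have hsplit : hi - b = (hi - e) + L := by omega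
      rw [← hL, hsplit, Nat.add_mul, Nat.add_mul]
      have hL1 : 1 ≤ L := by omega
      have hLg : L ≤ g := by omega
      have m1 : L * L ≤ L * g := Nat.mul_le_mul_left _ hLg
      have m2 : L * 1 ≤ L * g := Nat.mul_le_mul_left _ hg0
      have m3 : L * (L * 40 + 80) = 40 * (L * L) + 80 * L := by ring
      rw [m3]
      simp
      omega
  · simp [hlo]
    omega
  · rintro s' ⟨hF, ⟨h1, h2, h3, h4, t, ht, ht', hq⟩, hlt⟩
    have e5 : s'.nreg 5 = hi := by rw [hF.n 5 rfl]; simp [hhi]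
    simp only [Test.holds, NExpr.eval, e5] at hlt
    rw [show s'.nreg 7 = hi by omega] at hq ht
    exact ⟨h3, h4, t, ht, hq⟩

/-- Leaves in `rreg 5` an approximate median of the first `nreg 1` entries of array `2`. The
samples are stored one after the other behind these entries; each is cut into groups twice as
large as the one before. -/
def pivotProgram : Program :=
  (.nset 4 (.const 0) ;; .nset 5 (.reg 1) ;; .nset 6 (.const 48)) ;;
  .loop (.nle (.reg 6) (.sub (.reg 5) (.reg 4)))
    (levelProgram ;;
      (.nset 4 (.reg 5) ;; .nset 5 (.reg 9) ;; .nset 6 (.add (.reg 6) (.reg 6)))) ;;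
  (.nset 7 (.reg 4) ;; .nset 8 (.reg 5) ;; .nset 2 (.reg 4)) ;;
  .forLoop 2 5 (rankProgram ;;
    .branch
      (.and (.nle (.add (.reg 10) (.reg 10)) (.sub (.reg 5) (.reg 4)))
        (.nle (.sub (.reg 5) (.reg 4)) (.add (.add (.reg 10) (.reg 10)) (.const 1))))
      (.rset 5 (.load 2 (.reg 2)))
      .skip)

/-- The invariant of the sampling loop, where the current sample lies between the positions
`nreg 4` and `nreg 5` and is cut into groups of `nreg 6` entries. Each of its entries stands for `w`
of the original entries `f 0, …, f (m - 1)`, up to an error of `E`. With `g` for `nreg 6`, the field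
`error_le` says `E ≤ 12 * m * (1 / 48 - 1 / g)`. -/
structure SampleInv (f : ℕ → ℝ) (m : ℕ) (s : State) (w E : ℕ) : Prop where
  le_hi : m ≤ s.nreg 5
  lo_le_hi : s.nreg 4 ≤ s.nreg 5
  agree : ∀ i < m, s.rarr 2 i = f i
  group_ge : 48 ≤ s.nreg 6
  size_le : (s.nreg 5 - s.nreg 4) * s.nreg 6 ≤ 48 * m
  le_count : ∀ q, Antitone q →
    w * countIn q (s.rarr 2) (s.nreg 4) (s.nreg 5) ≤ countIn q f 0 m
  count_le : ∀ q, Antitone q →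
    countIn q f 0 m ≤ w * countIn q (s.rarr 2) (s.nreg 4) (s.nreg 5) + E
  error_le : 4 * s.nreg 6 * E + 48 * m ≤ m * s.nreg 6

/-- In a round, each group adds at most `3 * w` to the error. There are at most `2 * N / g` groups if
the sample has `N ≥ g` entries, and `w * N ≤ m`; so the error grows by at most `6 * m / g`. -/
theorem SampleInv.step {f : ℕ → ℝ} {m w E t hi' : ℕ} {s s' : State} (h : SampleInv f m s w E)
    (hN : s.nreg 6 ≤ s.nreg 5 - s.nreg 4)
    (h4 : s'.nreg 4 = s.nreg 5) (h5 : s'.nreg 5 = hi') (h6 : s'.nreg 6 = s.nreg 6 + s.nreg 6)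
    (hhi : s.nreg 5 ≤ hi') (ha : ∀ i < s.nreg 5, s'.rarr 2 i = s.rarr 2 i)
    (ht : t * s.nreg 6 ≤ s.nreg 5 - s.nreg 4 + s.nreg 6)
    (hq : ∀ q, Antitone q →
      4 * countIn q (s'.rarr 2) (s.nreg 5) hi' ≤
        countIn q (s.rarr 2) (s.nreg 4) (s.nreg 5) ∧
      countIn q (s.rarr 2) (s.nreg 4) (s.nreg 5) ≤
        4 * countIn q (s'.rarr 2) (s.nreg 5) hi' + 3 * t) :
    SampleInv f m s' (4 * w) (E + 3 * w * t) ∧ 4 * (hi' - s.nreg 5) ≤ s.nreg 5 - s.nreg 4 := by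
  have hm := h.le_hi
  have htot := (hq (fun _ => True) fun _ _ _ h => h).1
  rw [countIn_true, countIn_true] at htot
  have hwN := h.le_count (fun _ => True) fun _ _ _ h => h
  rw [countIn_true, countIn_true, Nat.sub_zero] at hwN
  refine ⟨⟨by omega, by omega, fun i hi => ?_, ?_, ?_, fun q hq' => ?_, fun q hq' => ?_,
    ?_⟩, htot⟩
  · rw [ha i (by omega), h.agree i hi]
  · have := h.group_ge
    omega
  · have := h.size_le
    rw [h4, h5, h6]
    have := Nat.mul_le_mul_right (s.nreg 6) htot
    rw [Nat.mul_add]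
    rw [Nat.mul_assoc] at this
    omega
  · have := Nat.mul_le_mul_left w (hq q hq').1
    have := h.le_count q hq'
    rw [h4, h5]
    linarith
  · have := Nat.mul_le_mul_left w (hq q hq').2
    have := h.count_le q hq'
    rw [h4, h5]
    linarith
  · have h1 := h.error_le
    have h2 := Nat.mul_le_mul_left w ht
    have h3 := Nat.mul_le_mul_left w hN
    rw [h6]
    nlinarith

/-- As the error is at most a quarter of `m`, the middle entry of a sample is an approximate
median. -/
theorem SampleInv.median {f : ℕ → ℝ} {m w E i : ℕ} {s : State} (h : SampleInv f m s w E)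
    (hi : s.nreg 4 ≤ i) (hi' : i < s.nreg 5)
    (hr : rankIn (s.rarr 2) (s.nreg 4) (s.nreg 5) i = (s.nreg 5 - s.nreg 4) / 2) :
    m ≤ 4 * countIn (· ≤ s.rarr 2 i) f 0 m ∧ m ≤ 4 * countIn (s.rarr 2 i ≤ ·) f 0 m := by
  have hE : 4 * E ≤ m := by
    have h1 := h.error_le
    have h2 := h.group_ge
    by_contra hlt
    have := Nat.mul_le_mul_right (s.nreg 6) (show m + 1 ≤ 4 * E by omega)
    nlinarith
  have htot := h.count_le (fun _ => True) fun _ _ _ h => h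
  rw [countIn_true, countIn_true, Nat.sub_zero] at htot
  have htot' := h.le_count (fun _ => True) fun _ _ _ h => h
  rw [countIn_true, countIn_true, Nat.sub_zero] at htot'
  set p := s.rarr 2 i
  have h1 := rankIn_lt_countIn_le (s.rarr 2) (Finset.mem_Ico.2 ⟨hi, hi'⟩)
  have h2 := countIn_lt_le_rankIn (s.rarr 2) (s.nreg 4) (s.nreg 5) i
  have h3 := h.le_count (· ≤ p) fun _ _ h h' => h.trans h'
  have h4 := h.count_le (· < p) fun _ _ h h' => h.trans_lt h'
  have h5 := countIn_add_countIn_not (· < p) f 0 m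
  simp only [not_lt] at h5
  rw [hr] at h1 h2
  obtain ⟨N, hN⟩ : ∃ N, N = s.nreg 5 - s.nreg 4 := ⟨_, rfl⟩
  rw [← hN] at h1 h2 htot htot'
  constructor
  · have := Nat.mul_le_mul_left w (show N ≤ 2 * countIn (· ≤ p) (s.rarr 2) (s.nreg 4) (s.nreg 5)
      by change N / 2 < countIn (· ≤ p) (s.rarr 2) (s.nreg 4) (s.nreg 5) at h1; omega)
    rw [Nat.mul_left_comm] at this
    omega
  · have := Nat.mul_le_mul_left w (show 2 * countIn (· < p) (s.rarr 2) (s.nreg 4) (s.nreg 5) ≤ N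
      by change countIn (· < p) (s.rarr 2) (s.nreg 4) (s.nreg 5) ≤ N / 2 at h2; omega)
    rw [Nat.mul_left_comm] at this
    omega

theorem pivotProgram_spec {s : State} {m : ℕ} (hm : s.nreg 1 = m) (hm0 : 0 < m) :
    Halts pivotProgram s (m * 100000) (fun s' =>
      (∀ i < m, s'.rarr 2 i = s.rarr 2 i) ∧
      m ≤ 4 * countIn (· ≤ s'.rreg 5) (s.rarr 2) 0 m ∧
      m ≤ 4 * countIn (s'.rreg 5 ≤ ·) (s.rarr 2) 0 m) := by
  refine Halts.mono (Halts.exec_seq rfl <| Halts.seq (Halts.loop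
      (fun s' => ∃ w E, SampleInv (s.rarr 2) m s' w E)
      (fun s' => (s'.nreg 5 - s'.nreg 4) * s'.nreg 6 * 500) ?_ ?_)
    fun s1 _ ⟨⟨w, E, hI⟩, hlt⟩ => Halts.exec_seq rfl <| Halts.mono (Halts.frame <| Halts.forLoop_const
      (a := s1.nreg 4) (c := s1.nreg 5)
      (fun i s' => (∃ j, s1.nreg 4 ≤ j ∧ j < s1.nreg 5 ∧
          rankIn (s1.rarr 2) (s1.nreg 4) (s1.nreg 5) j = (s1.nreg 5 - s1.nreg 4) / 2 ∧
          s'.rreg 5 = s1.rarr 2 j) ∨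
        ∀ j, s1.nreg 4 ≤ j → j < i →
          rankIn (s1.rarr 2) (s1.nreg 4) (s1.nreg 5) j ≠ (s1.nreg 5 - s1.nreg 4) / 2)
      ((s1.nreg 5 - s1.nreg 4) * 40 + 60) rfl rfl (by decide) ?_ ?_ hI.lo_le_hi ?_ ?_) (T' := m * 10000) ?_ ?_) ?_
    fun _ h => h
  · refine ⟨1, 0, by simp [hm], by simp, by simp, by simp, by simp [hm, Nat.mul_comm], ?_, ?_, ?_⟩
    · simp [hm]
    · simp [hm]
    · simp; omega
  · -- The size of a sample times the size of its groups is at least halved, and pays for a round.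
    rintro s' hF ⟨w, E, hI⟩ hb
    simp only [Test.holds, NExpr.eval] at hb
    have hg0 : 0 < s'.nreg 6 := lt_of_lt_of_le (by norm_num) hI.group_ge
    refine ⟨_, Halts.seq (levelProgram_spec rfl rfl rfl hg0 hI.lo_le_hi)
      fun s2 hF2 ⟨k1, k2, t, k3, k4⟩ => Halts.of_loopFree rfl le_rfl ?_⟩
    have e5 : s2.nreg 5 = s'.nreg 5 := hF2.n 5 rfl
    have e6 : s2.nreg 6 = s'.nreg 6 := hF2.n 6 rfl
    obtain ⟨hI', hN⟩ := hI.step (t := t) (hi' := s2.nreg 9) (s' := Program.exec s2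
      (.nset 4 (.reg 5) ;; .nset 5 (.reg 9) ;; .nset 6 (.add (.reg 6) (.reg 6)))) hb
      (by simp [e5]) (by simp) (by simp [e6]) k1 (by simpa using k2) k3 (by simpa using k4)
    refine ⟨⟨_, _, hI'⟩, ?_⟩
    have hg1 : 48 * 48 ≤ (s'.nreg 5 - s'.nreg 4) * s'.nreg 6 :=
      Nat.mul_le_mul (hI.group_ge.trans hb) hI.group_ge
    have := Nat.mul_le_mul_right (s'.nreg 6) hN
    rw [Nat.mul_assoc] at this
    simp [e5, e6, Nat.mul_add]
    omega
  · simp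
  · simp
  · exact .inr fun j h1 h2 => by omega
  · intro i s' hi hi' hF hi2 hinv
    have e4 : s'.nreg 4 = s1.nreg 4 := by rw [hF.n 4 rfl]; simp
    have e5 : s'.nreg 5 = s1.nreg 5 := by rw [hF.n 5 rfl]; simp
    have e7 : s'.nreg 7 = s1.nreg 4 := by rw [hF.n 7 rfl]; simp
    have e8 : s'.nreg 8 = s1.nreg 5 := by rw [hF.n 8 rfl]; simp
    have ea : s'.rarr 2 = s1.rarr 2 := by rw [hF.a 2 rfl]; simp
    refine Halts.mono ((rankProgram_spec s' (by omega)).seq (T' := 40) fun s2 hF2 hr => ?_) ?_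
      fun _ h => h
    · rw [e7, e8, ea, hi2] at hr
      refine Halts.of_loopFree rfl (by decide) ?_
      have f4 : s2.nreg 4 = s1.nreg 4 := by rw [hF2.n 4 rfl, e4]
      have f5 : s2.nreg 5 = s1.nreg 5 := by rw [hF2.n 5 rfl, e5]
      have f2 : s2.nreg 2 = i := by rw [hF2.n 2 rfl, hi2]
      have fa : s2.rarr 2 = s1.rarr 2 := by rw [hF2.a 2 rfl, ea]
      have fr : s2.rreg 5 = s'.rreg 5 := hF2.r 5 rfl
      set r := rankIn (s1.rarr 2) (s1.nreg 4) (s1.nreg 5) i with hrdef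
      by_cases hc : r = (s1.nreg 5 - s1.nreg 4) / 2
      · have hc1 : r + r ≤ s1.nreg 5 - s1.nreg 4 := by omega
        have hc2 : s1.nreg 5 - s1.nreg 4 ≤ r + r + 1 := by omega
        refine .inl ⟨i, hi, hi', hc, ?_⟩
        simp only [Program.exec, Test.holds, NExpr.eval, hr.1, f4, f5]
        rw [if_pos ⟨hc1, hc2⟩]
        simp [f2, fa]
      · have hc' : ¬ (r + r ≤ s1.nreg 5 - s1.nreg 4 ∧ s1.nreg 5 - s1.nreg 4 ≤ r + r + 1) := by
          omega
        simp only [Program.exec, Test.holds, NExpr.eval, hr.1, f4, f5]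
        rw [if_neg hc', fr]
        rcases hinv with h | h
        · exact .inl h
        · refine .inr fun j hj hj' => ?_
          rcases Nat.lt_succ_iff_lt_or_eq.1 hj' with h' | rfl
          · exact h j hj h'
          · exact hc
    · rw [e7, e8]
  · simp only [Test.holds, NExpr.eval] at hlt
    have h1 := hI.size_le
    have h2 := Nat.mul_le_mul_left (s1.nreg 5 - s1.nreg 4)
      (show s1.nreg 5 - s1.nreg 4 ≤ s1.nreg 6 by omega)
    have h3 := Nat.mul_le_mul_left (s1.nreg 5 - s1.nreg 4)
      (show 1 ≤ s1.nreg 6 from le_trans (by norm_num) hI.group_ge)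
    obtain ⟨N, hN⟩ : ∃ N, N = s1.nreg 5 - s1.nreg 4 := ⟨_, rfl⟩
    rw [← hN] at h1 h2 h3 ⊢
    have : N * (N * 40 + 60 + 10) = 40 * (N * N) + 70 * N := by ring
    omega
  · rintro s' ⟨hF, hQ⟩
    have ea : s'.rarr 2 = s1.rarr 2 := by rw [hF.a 2 rfl]; simp
    rw [ea]
    refine ⟨hI.agree, ?_⟩
    have hN : 0 < s1.nreg 5 - s1.nreg 4 := by
      have h1 := hI.count_le (fun _ => True) fun _ _ _ h => h
      rw [countIn_true, countIn_true, Nat.sub_zero] at h1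
      have h2 := hI.error_le
      by_contra h0
      rw [show s1.nreg 5 - s1.nreg 4 = 0 by omega, Nat.mul_zero, Nat.zero_add] at h1
      nlinarith [hI.group_ge, Nat.mul_le_mul_left (s1.nreg 6) h1]
    rcases hQ with ⟨j, hj, hj', hr, hp⟩ | h
    · rw [hp]
      exact hI.median hj hj' hr
    · obtain ⟨j, hj, hr⟩ := exists_rankIn_eq (s1.rarr 2) (b := s1.nreg 4) (e := s1.nreg 5)
        (r := (s1.nreg 5 - s1.nreg 4) / 2) (by omega)
      rw [Finset.mem_Ico] at hj
      exact absurd hr (h j hj.1 hj.2)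
  · simp [hm]
    omega

end RealRAM

/-! ### Prune and search -/

section Load

open Classical

/-- The total of the second components of those triples whose first component satisfies `q`. -/
noncomputable def slopeSum (q : ℝ → Prop) (l : List (ℝ × ℝ × ℝ)) : ℝ :=
  (l.map fun t => if q t.1 then t.2.1 else 0).sum

/-- The total of the third components of those triples whose first component satisfies `q`. -/
noncomputable def offsetSum (q : ℝ → Prop) (l : List (ℝ × ℝ × ℝ)) : ℝ :=
  (l.map fun t => if q t.1 then t.2.2 else 0).sum

/-- A triple `(x, a, b)` stands for the function that is `0` up to `x` and `c ↦ a * c + b`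
beyond it. This is the sum of the functions of the list. -/
noncomputable def load (l : List (ℝ × ℝ × ℝ)) (c : ℝ) : ℝ :=
  slopeSum (· < c) l * c + offsetSum (· < c) l

@[simp] theorem slopeSum_nil (q : ℝ → Prop) : slopeSum q [] = 0 := rfl

@[simp] theorem offsetSum_nil (q : ℝ → Prop) : offsetSum q [] = 0 := rfl

@[simp] theorem slopeSum_cons (q : ℝ → Prop) (t : ℝ × ℝ × ℝ) (l : List (ℝ × ℝ × ℝ)) :
    slopeSum q (t :: l) = (if q t.1 then t.2.1 else 0) + slopeSum q l := by
  simp [slopeSum]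

@[simp] theorem offsetSum_cons (q : ℝ → Prop) (t : ℝ × ℝ × ℝ) (l : List (ℝ × ℝ × ℝ)) :
    offsetSum q (t :: l) = (if q t.1 then t.2.2 else 0) + offsetSum q l := by
  simp [offsetSum]

theorem slopeSum_append (q : ℝ → Prop) (l l' : List (ℝ × ℝ × ℝ)) :
    slopeSum q (l ++ l') = slopeSum q l + slopeSum q l' := by
  simp [slopeSum]

theorem offsetSum_append (q : ℝ → Prop) (l l' : List (ℝ × ℝ × ℝ)) :
    offsetSum q (l ++ l') = offsetSum q l + offsetSum q l' := by
  simp [offsetSum]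

theorem load_filter_lt {p c : ℝ} (h : c ≤ p) (l : List (ℝ × ℝ × ℝ)) :
    load (l.filter fun t => t.1 < p) c = load l c := by
  unfold load
  induction l with
  | nil => simp
  | cons t l ih =>
    rw [List.filter_cons]
    split_ifs with ht
    · simp only [slopeSum_cons, offsetSum_cons]
      linarith
    · have : ¬ t.1 < c := fun h' => ht (by simpa using h'.trans_le h)
      simp [this, ih]

theorem load_filter_gt {p c : ℝ} (h : p < c) (l : List (ℝ × ℝ × ℝ)) :
    load l c = slopeSum (· ≤ p) l * c + offsetSum (· ≤ p) l + load (l.filter fun t => p < t.1) c := by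
  unfold load
  induction l with
  | nil => simp
  | cons t l ih =>
    rw [List.filter_cons]
    by_cases ht : p < t.1
    · simp only [slopeSum_cons, offsetSum_cons, ht, not_le.2 ht, if_true, if_false, decide_true]
      linarith
    · have : t.1 < c := (not_lt.1 ht).trans_lt h
      simp only [slopeSum_cons, offsetSum_cons, this, not_lt.1 ht, ht, if_true, decide_false]
      simp only [Bool.false_eq_true, if_false]
      linarith

/-- The invariant of the search for the largest `x` among the triples `(x, a, b)` of `l₀` with
`load l₀ x ≤ K`. The triples of `l` are still undecided; those that were found to lie below the
answer are accounted for by `W` and `S`; the largest point known to carry a load of at most `K`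
is `best` (which is meaningless until the first such point is found). -/
structure SearchInv (l₀ : List (ℝ × ℝ × ℝ)) (K : ℝ) (l : List (ℝ × ℝ × ℝ)) (W S best : ℝ) :
    Prop where
  load_eq : ∀ c, (∃ t ∈ l, t.1 ≤ c) → (∃ t ∈ l, c ≤ t.1) → load l₀ c = W * c + S + load l c
  mem_or : ∀ t ∈ l₀, load l₀ t.1 ≤ K → t ∈ l ∨ t.1 ≤ best ∧ ∀ t' ∈ l, best ≤ t'.1
  best_or : load l₀ best ≤ K ∨ ∃ t ∈ l, load l₀ t.1 ≤ K

variable {l₀ l : List (ℝ × ℝ × ℝ)} {K W S best p : ℝ}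

/-- If the load at the pivot `p` is small enough, the triples up to `p` are settled. -/
theorem SearchInv.step_le (h : SearchInv l₀ K l W S best) (hp : ∃ t ∈ l, t.1 ≤ p)
    (hp' : ∃ t ∈ l, p ≤ t.1) (hK : W * p + S + load l p ≤ K) :
    SearchInv l₀ K (l.filter fun t => p < t.1) (W + slopeSum (· ≤ p) l) (S + offsetSum (· ≤ p) l) p where
  load_eq c := by
    rintro ⟨t, ht, htc⟩ ⟨t', ht', hct'⟩
    simp only [List.mem_filter, decide_eq_true_eq] at ht ht'
    rw [h.load_eq c ⟨t, ht.1, htc⟩ ⟨t', ht'.1, hct'⟩, load_filter_gt (ht.2.trans_le htc)]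
    ring
  mem_or t ht htK := by
    simp only [List.mem_filter, decide_eq_true_eq]
    by_cases htp : p < t.1
    · rcases h.mem_or t ht htK with h' | ⟨h1, h2⟩
      · exact .inl ⟨h', htp⟩
      · obtain ⟨t', ht', hp⟩ := hp
        linarith [h2 t' ht']
    · exact .inr ⟨not_lt.1 htp, fun t' ht' => ht'.2.le⟩
  best_or := .inl (by rwa [h.load_eq p hp hp'])

/-- If the load at the pivot `p` is too large, the triples from `p` on can be dropped. -/
theorem SearchInv.step_gt (h : SearchInv l₀ K l W S best) (hmono : Monotone (load l₀))
    (hp : ∃ t ∈ l, t.1 ≤ p) (hp' : ∃ t ∈ l, p ≤ t.1) (hK : ¬ W * p + S + load l p ≤ K) :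
    SearchInv l₀ K (l.filter fun t => t.1 < p) W S best := by
  rw [← h.load_eq p hp hp'] at hK
  have hlt : ∀ t : ℝ × ℝ × ℝ, load l₀ t.1 ≤ K → t.1 < p := fun t ht =>
    lt_of_not_ge fun h' => hK ((hmono h').trans ht)
  refine ⟨fun c => ?_, fun t ht htK => ?_, ?_⟩
  · rintro ⟨t, ht, htc⟩ ⟨t', ht', hct'⟩
    simp only [List.mem_filter, decide_eq_true_eq] at ht ht'
    rw [h.load_eq c ⟨t, ht.1, htc⟩ ⟨t', ht'.1, hct'⟩, load_filter_lt (hct'.trans ht'.2.le)]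
  · simp only [List.mem_filter, decide_eq_true_eq]
    exact (h.mem_or t ht htK).imp (fun h' => ⟨h', hlt t htK⟩)
      fun h' => ⟨h'.1, fun t' ht' => h'.2 t' ht'.1⟩
  · refine h.best_or.imp_right ?_
    rintro ⟨t, ht, htK⟩
    exact ⟨t, by simpa using ⟨ht, hlt t htK⟩, htK⟩

end Load

namespace RealRAM

/-- The first `m` triples that are stored in the arrays `2`, `3` and `4`. -/
noncomputable def items (s : State) (m : ℕ) : List (ℝ × ℝ × ℝ) :=
  (List.range m).map fun i => (s.rarr 2 i, s.rarr 3 i, s.rarr 4 i)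

theorem items_succ (s : State) (m : ℕ) :
    items s (m + 1) = items s m ++ [(s.rarr 2 m, s.rarr 3 m, s.rarr 4 m)] := by
  simp [items, List.range_succ]

@[simp] theorem length_items (s : State) (m : ℕ) : (items s m).length = m := by
  simp [items]

theorem items_congr {s s' : State} {m : ℕ} (h2 : ∀ i < m, s'.rarr 2 i = s.rarr 2 i)
    (h3 : ∀ i < m, s'.rarr 3 i = s.rarr 3 i) (h4 : ∀ i < m, s'.rarr 4 i = s.rarr 4 i) :
    items s' m = items s m := by
  refine List.map_congr_left fun i hi => ?_
  rw [List.mem_range] at hi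
  rw [h2 i hi, h3 i hi, h4 i hi]

open Classical in
theorem countIn_eq_countP (q : ℝ → Prop) (s : State) (m : ℕ) :
    countIn q (s.rarr 2) 0 m = (items s m).countP fun t => q t.1 := by
  induction m with
  | zero => simp [countIn, cardIn_self, items]
  | succ m ih =>
    rw [countIn, cardIn_succ m.zero_le, items_succ, List.countP_append, ← ih, countIn]
    simp [List.countP_singleton]

/-- Adds to `rreg 2` and `rreg 3` the slopes and offsets of the stored triples that lie below
`rreg 5`, strictly (with results in `rreg 7` and `rreg 8`) or weakly (in `rreg 9` and
`rreg 10`). -/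
def evalProgram : Program :=
  (.nset 2 (.const 0) ;; .rset 7 (.reg 2) ;; .rset 8 (.reg 3) ;;
    .rset 9 (.reg 2) ;; .rset 10 (.reg 3)) ;;
  .forLoop 2 1 (.branch (.rle (.load 2 (.reg 2)) (.reg 5))
    ((.rset 9 (.add (.reg 9) (.load 3 (.reg 2))) ;; .rset 10 (.add (.reg 10) (.load 4 (.reg 2)))) ;;
      .branch (.rle (.reg 5) (.load 2 (.reg 2)))
        .skip
        (.rset 7 (.add (.reg 7) (.load 3 (.reg 2))) ;; .rset 8 (.add (.reg 8) (.load 4 (.reg 2)))))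
    .skip)

theorem evalProgram_spec {s : State} {m : ℕ} {p : ℝ} (hm : s.nreg 1 = m) (hp : s.rreg 5 = p) :
    Halts evalProgram s (m * 70 + 30) (fun s' =>
      s'.rreg 7 = s.rreg 2 + slopeSum (· < p) (items s m) ∧
      s'.rreg 8 = s.rreg 3 + offsetSum (· < p) (items s m) ∧
      s'.rreg 9 = s.rreg 2 + slopeSum (· ≤ p) (items s m) ∧
      s'.rreg 10 = s.rreg 3 + offsetSum (· ≤ p) (items s m)) := by
  refine Halts.mono (Halts.exec_seq rfl <| Halts.forLoop_const (a := 0) (c := m) (fun i s' =>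
      s'.rreg 7 = s.rreg 2 + slopeSum (· < p) (items s i) ∧
      s'.rreg 8 = s.rreg 3 + offsetSum (· < p) (items s i) ∧
      s'.rreg 9 = s.rreg 2 + slopeSum (· ≤ p) (items s i) ∧
      s'.rreg 10 = s.rreg 3 + offsetSum (· ≤ p) (items s i))
    60 rfl rfl (by decide) ?_ ?_ m.zero_le ?_ ?_) ?_ fun _ h => h
  · simp
  · simp [hm]
  · simp [items]
  · rintro i s' - hi hF hi2 ⟨h1, h2, h3, h4⟩
    have e2 : s'.rarr 2 = s.rarr 2 := by rw [hF.a 2 rfl]; simp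
    have e3 : s'.rarr 3 = s.rarr 3 := by rw [hF.a 3 rfl]; simp
    have e4 : s'.rarr 4 = s.rarr 4 := by rw [hF.a 4 rfl]; simp
    have e5 : s'.rreg 5 = p := by rw [hF.r 5 rfl]; simp [hp]
    refine Halts.of_loopFree rfl (by decide) ?_
    simp only [items_succ, slopeSum_append, offsetSum_append]
    by_cases hle : s.rarr 2 i ≤ p
    · by_cases hge : p ≤ s.rarr 2 i
      · simp [hi2, e2, e3, e4, e5, h1, h2, h3, h4, hle, hge, not_lt.2 hge, add_assoc]
      · simp [hi2, e2, e3, e4, e5, h1, h2, h3, h4, hle, hge, not_le.1 hge, add_assoc]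
    · have : ¬ s.rarr 2 i < p := fun h => hle h.le
      simp [hi2, e2, e5, h1, h2, h3, h4, hle, this]
  · simp
    omega

/-- Keeps those of the stored triples whose first component lies above (if `rreg 11` is positive)
or below (if it is negative) `rreg 5`. -/
def filterProgram : Program :=
  (.nset 2 (.const 0) ;; .nset 3 (.const 0)) ;;
  .forLoop 2 1 (.branch (.rle (.mul (.reg 11) (.load 2 (.reg 2))) (.mul (.reg 11) (.reg 5)))
    .skip
    (.rstore 2 (.reg 3) (.load 2 (.reg 2)) ;; .rstore 3 (.reg 3) (.load 3 (.reg 2)) ;;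
      .rstore 4 (.reg 3) (.load 4 (.reg 2)) ;; .nset 3 (.add (.reg 3) (.const 1)))) ;;
  .nset 1 (.reg 3)

theorem filterProgram_spec {s : State} {m : ℕ} {p σ : ℝ} (hm : s.nreg 1 = m) (hp : s.rreg 5 = p)
    (hσ : s.rreg 11 = σ) :
    Halts filterProgram s (m * 70 + 30) (fun s' =>
      items s' (s'.nreg 1) = (items s m).filter fun t => σ * p < σ * t.1) := by
  refine Halts.mono (Halts.exec_seq rfl <| Halts.seq (T' := 5)
    (Halts.forLoop_const (a := 0) (c := m) (fun i s' =>
      s'.nreg 3 ≤ i ∧ (∀ j, i ≤ j → s'.rarr 2 j = s.rarr 2 j) ∧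
      (∀ j, i ≤ j → s'.rarr 3 j = s.rarr 3 j) ∧ (∀ j, i ≤ j → s'.rarr 4 j = s.rarr 4 j) ∧
      items s' (s'.nreg 3) = (items s i).filter fun t => σ * p < σ * t.1)
    60 rfl rfl (by decide) ?_ ?_ m.zero_le ?_ ?_) ?_) ?_ fun _ h => h
  · simp
  · simp [hm]
  · simp [items]
  · rintro i s' - hi hF hi2 ⟨h0, h2, h3, h4, h⟩
    have e5 : s'.rreg 5 = p := by rw [hF.r 5 rfl]; simp [hp]
    have e11 : s'.rreg 11 = σ := by rw [hF.r 11 rfl]; simp [hσ]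
    have v2 := h2 i le_rfl
    have v3 := h3 i le_rfl
    have v4 := h4 i le_rfl
    refine Halts.of_loopFree rfl (by decide) ?_
    rw [items_succ, List.filter_append, ← h]
    by_cases hle : σ * s.rarr 2 i ≤ σ * p
    · simp [hi2, e5, e11, v2, hle, not_lt.2 hle]
      exact ⟨h0.trans i.le_succ, fun j hj => h2 j hj.le, fun j hj => h3 j hj.le,
        fun j hj => h4 j hj.le, rfl⟩
    · have hgt := not_le.1 hle
      simp [hi2, e5, e11, v2, hle, hgt, v3, v4]
      refine ⟨h0, fun j hj => ?_, fun j hj => ?_, fun j hj => ?_, ?_⟩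
      · rw [Function.update_of_ne (by omega), h2 j hj.le]
      · rw [Function.update_of_ne (by omega), h3 j hj.le]
      · rw [Function.update_of_ne (by omega), h4 j hj.le]
      · rw [items_succ]
        congr 1
        · refine items_congr ?_ ?_ ?_ <;> intro j hj <;> simp [Function.update_of_ne hj.ne]
        · simp
  · intro s' _ h
    refine Halts.of_loopFree rfl (by decide) ?_
    simpa [items] using h.2.2.2.2
  · simp
    omega

/-- Prune and search among the `nreg 1` triples `(x, a, b)` that are stored in the arrays `2`, `3` and
`4`: leaves in `rreg 4` a point of load at most `rreg 1` that is an upper bound for all stored `x` of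
load at most `rreg 1`. The triples are overwritten. -/
def searchProgram : Program :=
  (.rset 2 (.const 0) ;; .rset 3 (.const 0)) ;;
  .loop (.nle (.const 1) (.reg 1))
    (pivotProgram ;; evalProgram ;;
      .branch (.rle (.add (.mul (.reg 7) (.reg 5)) (.reg 8)) (.reg 1))
        (.rset 4 (.reg 5) ;; .rset 2 (.reg 9) ;; .rset 3 (.reg 10) ;; .rset 11 (.const 1))
        (.rset 11 (.sub (.const 0) (.const 1))) ;;
      filterProgram)

/-- The result need not be one of the stored bounds: it is a point with load at most `K` that
no stored bound with load at most `K` exceeds. -/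
theorem searchProgram_spec {s : State} {m : ℕ} {K : ℝ} {l : List (ℝ × ℝ × ℝ)}
    (hm : s.nreg 1 = m) (hK : s.rreg 1 = K) (hl : items s m = l) (hmono : Monotone (load l))
    (hex : ∃ t ∈ l, load l t.1 ≤ K) :
    Halts searchProgram s (m * 500000 + 20) (fun s' =>
      load l (s'.rreg 4) ≤ K ∧ ∀ t ∈ l, load l t.1 ≤ K → t.1 ≤ s'.rreg 4) := by
  refine Halts.mono (Halts.exec_seq rfl <| Halts.loop
    (fun s' => SearchInv l K (items s' (s'.nreg 1)) (s'.rreg 2) (s'.rreg 3) (s'.rreg 4))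
    (fun s' => s'.nreg 1 * 480000) ?_ ?_) ?_ ?_
  · have : items (Program.exec s (.rset 2 (.const 0) ;; .rset 3 (.const 0)))
        ((Program.exec s (.rset 2 (.const 0) ;; .rset 3 (.const 0))).nreg 1) = l := by
      rw [← hl, ← hm]
      rfl
    rw [this]
    refine ⟨fun c _ _ => by simp, fun t ht _ => .inl ht, .inr hex⟩
  · -- A round takes time proportional to the number of triples left, and removes a quarter of them.
    intro s' hF hI hb
    simp only [Test.holds, NExpr.eval] at hb
    obtain ⟨k, hk⟩ : ∃ k, s'.nreg 1 = k := ⟨_, rfl⟩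
    rw [hk] at hb hI
    have hK' : s'.rreg 1 = K := by rw [hF.r 1 rfl]; simp [hK]
    refine ⟨_, Halts.seq (T' := k * 140 + 100) (pivotProgram_spec hk hb)
      fun s1 hF1 ⟨p1, p2, p3⟩ => Halts.mono (Halts.seq (T' := k * 70 + 60)
        (evalProgram_spec ((hF1.n 1 rfl).trans hk) rfl)
        fun s2 hF2 ⟨r7, r8, r9, r10⟩ => ?_) (by omega) fun _ h => h⟩
    obtain ⟨p, hp⟩ : ∃ p, s1.rreg 5 = p := ⟨_, rfl⟩
    obtain ⟨l', hl'⟩ : ∃ l', items s' k = l' := ⟨_, rfl⟩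
    have hlen : l'.length = k := by rw [← hl', length_items]
    have hl1 : items s1 k = l' := by
      rw [← hl']
      exact items_congr p1 (fun i _ => by rw [hF1.a 3 rfl]) (fun i _ => by rw [hF1.a 4 rfl])
    have hl2 : items s2 k = l' := by
      rw [← hl1]
      exact items_congr (fun i _ => by rw [hF2.a 2 rfl]) (fun i _ => by rw [hF2.a 3 rfl])
        (fun i _ => by rw [hF2.a 4 rfl])
    have e1 : s2.nreg 1 = k := by rw [hF2.n 1 rfl, hF1.n 1 rfl, hk]
    have eK : s2.rreg 1 = K := by rw [hF2.r 1 rfl, hF1.r 1 rfl, hK']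
    have e5 : s2.rreg 5 = p := by rw [hF2.r 5 rfl, hp]
    have e2 : s2.rreg 2 = s'.rreg 2 := by rw [hF2.r 2 rfl, hF1.r 2 rfl]
    have e3 : s2.rreg 3 = s'.rreg 3 := by rw [hF2.r 3 rfl, hF1.r 3 rfl]
    have e4 : s2.rreg 4 = s'.rreg 4 := by rw [hF2.r 4 rfl, hF1.r 4 rfl]
    rw [hp, hl1, hF1.r 2 rfl] at r7 r9
    rw [hp, hl1, hF1.r 3 rfl] at r8 r10
    rw [hp, countIn_eq_countP, hl'] at p2 p3
    rw [hl'] at hI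
    have hle : ∃ t ∈ l', t.1 ≤ p := by
      have := List.countP_pos_iff.1 (show 0 < l'.countP fun t => t.1 ≤ p by omega)
      simpa using this
    have hge : ∃ t ∈ l', p ≤ t.1 := by
      have := List.countP_pos_iff.1 (show 0 < l'.countP fun t => p ≤ t.1 by omega)
      simpa using this
    have hval : s2.rreg 7 * p + s2.rreg 8 = s'.rreg 2 * p + s'.rreg 3 + load l' p := by
      rw [r7, r8, load]
      ring
    by_cases hc : s'.rreg 2 * p + s'.rreg 3 + load l' p ≤ K
    · refine Halts.mono (Halts.exec_seq rfl (Halts.frame (filterProgram_spec (m := k) (p := p)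
        (σ := 1) ?_ ?_ ?_))) ?_ fun s4 ⟨hF4, h4⟩ => ?_
      · simp [e5, eK, hval, hc, e1]
      · simp [e5, eK, hval, hc]
      · simp [e5, eK, hval, hc]
      · simp
        omega
      · have hit : items s4 (s4.nreg 1) = l'.filter fun t => p < t.1 := by
          rw [h4, ← hl2]
          simp [e5, eK, hval, hc, items]
        have q2 : s4.rreg 2 = s'.rreg 2 + slopeSum (· ≤ p) l' := by
          rw [hF4.r 2 rfl]
          simp [e5, eK, hval, hc, r9]
        have q3 : s4.rreg 3 = s'.rreg 3 + offsetSum (· ≤ p) l' := by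
          rw [hF4.r 3 rfl]
          simp [e5, eK, hval, hc, r10]
        have q4 : s4.rreg 4 = p := by
          rw [hF4.r 4 rfl]
          simp [e5, eK, hval, hc]
        refine ⟨?_, ?_⟩
        · rw [hit, q2, q3, q4]
          exact hI.step_le hle hge hc
        · have hn := congrArg List.length hit
          rw [length_items, ← List.countP_eq_length_filter] at hn
          have hsum := List.length_eq_countP_add_countP (fun t : ℝ × ℝ × ℝ => t.1 ≤ p) (l := l')
          simp only [decide_eq_true_eq, not_le] at hsum
          simp
          omega
    · refine Halts.mono (Halts.exec_seq rfl (Halts.frame (filterProgram_spec (m := k) (p := p)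
        (σ := -1) ?_ ?_ ?_))) ?_ fun s4 ⟨hF4, h4⟩ => ?_
      · simp [e5, eK, hval, hc, e1]
      · simp [e5, eK, hval, hc]
      · simp [e5, eK, hval, hc]
      · simp
        omega
      · have hit : items s4 (s4.nreg 1) = l'.filter fun t => t.1 < p := by
          rw [h4, ← hl2]
          simp [e5, eK, hval, hc, items]
        have q2 : s4.rreg 2 = s'.rreg 2 := by
          rw [hF4.r 2 rfl]
          simp [e5, eK, hval, hc, e2]
        have q3 : s4.rreg 3 = s'.rreg 3 := by
          rw [hF4.r 3 rfl]
          simp [e5, eK, hval, hc, e3]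
        have q4 : s4.rreg 4 = s'.rreg 4 := by
          rw [hF4.r 4 rfl]
          simp [e5, eK, hval, hc, e4]
        refine ⟨?_, ?_⟩
        · rw [hit, q2, q3, q4]
          exact hI.step_gt hmono hle hge hc
        · have hn := congrArg List.length hit
          rw [length_items, ← List.countP_eq_length_filter] at hn
          have hsum := List.length_eq_countP_add_countP (fun t : ℝ × ℝ × ℝ => p ≤ t.1) (l := l')
          simp only [decide_eq_true_eq, not_le] at hsum
          simp
          omega
  · simp [hm]
    omega
  · rintro s' ⟨hI, hlt⟩
    simp only [Test.holds, NExpr.eval, not_le, Nat.lt_one_iff] at hlt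
    rw [hlt] at hI
    have h0 : items s' 0 = [] := rfl
    rw [h0] at hI
    exact ⟨by simpa using hI.best_or, fun t ht htK => by simpa using hI.mem_or t ht htK⟩

end RealRAM

/-! ### Counting in arithmetic progressions -/

section Progressions

open Finset

/-- The number of `j` with `x + y * j < τ`. -/
noncomputable def numLT (x y τ : ℝ) : ℕ :=
  ⌈(τ - x) / y⌉₊

/-- The number of `j` with `x + y * j ≤ τ`. -/
noncomputable def numLE (x y τ : ℝ) : ℕ :=
  if x ≤ τ then ⌊(τ - x) / y⌋₊ + 1 else 0

theorem lt_numLT_iff {x y τ : ℝ} (hy : 0 < y) {j : ℕ} : j < numLT x y τ ↔ x + y * j < τ := by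
  rw [numLT, Nat.lt_ceil, lt_div_iff₀ hy]
  constructor <;> intro h <;> linarith

theorem lt_numLE_iff {x y τ : ℝ} (hy : 0 < y) {j : ℕ} : j < numLE x y τ ↔ x + y * j ≤ τ := by
  unfold numLE
  split_ifs with h
  · rw [Nat.lt_succ_iff, Nat.le_floor_iff (div_nonneg (by linarith) hy.le), le_div_iff₀ hy]
    constructor <;> intro h <;> linarith
  · have : 0 ≤ y * j := by positivity
    constructor
    · intro h'
      omega
    · intro h'
      linarith

theorem numLT_le_numLE {x y τ τ' : ℝ} (hy : 0 < y) (h : τ ≤ τ') : numLT x y τ ≤ numLE x y τ' :=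
  le_of_forall_lt fun _ hj => (lt_numLE_iff hy).2 (((lt_numLT_iff hy).1 hj).le.trans h)

theorem numLT_mono {x y τ τ' : ℝ} (hy : 0 < y) (h : τ ≤ τ') : numLT x y τ ≤ numLT x y τ' :=
  Nat.ceil_mono (by gcongr)

theorem numLT_lt {x y τ : ℝ} : (numLT x y τ : ℝ) < max 0 ((τ - x) / y) + 1 := by
  unfold numLT
  rcases le_total 0 ((τ - x) / y) with h | h
  · rw [max_eq_right h]
    exact Nat.ceil_lt_add_one h
  · rw [Nat.ceil_eq_zero.2 h, max_eq_left h]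
    norm_num

theorem le_numLT {x y τ : ℝ} : max 0 ((τ - x) / y) ≤ numLT x y τ :=
  max_le (Nat.cast_nonneg _) (Nat.le_ceil _)

theorem le_numLE {x y τ : ℝ} (hy : 0 < y) : max 0 ((τ - x) / y) ≤ numLE x y τ := by
  refine max_le (Nat.cast_nonneg _) ?_
  unfold numLE
  split_ifs with h
  · push_cast
    exact (Nat.lt_floor_add_one _).le
  · rw [Nat.cast_zero]
    exact div_nonpos_of_nonpos_of_nonneg (by linarith) hy.le

theorem numLE_le {x y τ : ℝ} (hy : 0 < y) : (numLE x y τ : ℝ) ≤ max 0 ((τ - x) / y) + 1 := by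
  unfold numLE
  split_ifs with h
  · have : 0 ≤ (τ - x) / y := div_nonneg (by linarith) hy.le
    push_cast
    rw [max_eq_right this]
    linarith [Nat.floor_le this]
  · have := le_max_left 0 ((τ - x) / y)
    rw [Nat.cast_zero]
    linarith

theorem numLE_le_numLT_add_one {x y τ : ℝ} (hy : 0 < y) : numLE x y τ ≤ numLT x y τ + 1 := by
  refine le_of_forall_lt fun j hj => ?_
  rcases j with _ | j
  · omega
  · have h1 := (lt_numLE_iff hy).1 hj
    push_cast at h1
    have := (lt_numLT_iff hy (j := j) (τ := τ) (x := x)).2 (by nlinarith)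
    omega

/-- A continuous approximation, from below and up to `n`, of the number of terms up to `τ` in the
progressions `x i + y i * j` for `i < n`. -/
noncomputable def mass (x y : ℕ → ℝ) (n : ℕ) (τ : ℝ) : ℝ :=
  ∑ i ∈ range n, max 0 ((τ - x i) / y i)

variable {x y : ℕ → ℝ} {n : ℕ}

theorem mass_mono (hy : ∀ i < n, 0 < y i) : Monotone (mass x y n) := by
  intro a b hab
  refine sum_le_sum fun i hi => max_le_max le_rfl ?_
  have := hy i (mem_range.1 hi)
  gcongr

theorem load_map_range (g : ℕ → ℝ × ℝ × ℝ) (n : ℕ) (c : ℝ) :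
    load ((List.range n).map g) c =
      ∑ i ∈ range n, if (g i).1 < c then (g i).2.1 * c + (g i).2.2 else 0 := by
  induction n with
  | zero => simp [load]
  | succ n ih =>
    rw [List.range_succ, List.map_append, sum_range_succ, ← ih, load, load, slopeSum_append,
      offsetSum_append]
    simp only [List.map_cons, List.map_nil, slopeSum_cons, offsetSum_cons, slopeSum_nil,
      offsetSum_nil]
    split_ifs <;> ring

theorem load_eq_mass (hy : ∀ i < n, 0 < y i) (c : ℝ) :
    load ((List.range n).map fun i => (x i, 1 / y i, 0 - x i / y i)) c = mass x y n c := by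
  rw [load_map_range, mass]
  refine sum_congr rfl fun i hi => ?_
  have := hy i (mem_range.1 hi)
  split_ifs with h
  · rw [max_eq_right (div_nonneg (by linarith) this.le)]
    ring
  · rw [max_eq_left (div_nonpos_of_nonpos_of_nonneg (by linarith) this.le)]

/-- The mass is a linear function from the last `x i` whose mass is at most `K` up to the
next one, and takes the value `K` between them. -/
theorem mass_solution (hy : ∀ i < n, 0 < y i) {K z : ℝ} (hz : mass x y n z ≤ K)
    (hmax : ∀ i < n, mass x y n (x i) ≤ K → x i ≤ z) (hex : ∃ i < n, x i ≤ z) {τ : ℝ}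
    (hτ : τ = (K + ∑ i ∈ range n, if x i ≤ z then x i / y i else 0) /
      ∑ i ∈ range n, if x i ≤ z then 1 / y i else 0) :
    mass x y n τ = K ∧ z ≤ τ := by
  set A := ∑ i ∈ range n, if x i ≤ z then 1 / y i else 0 with hA
  set B := ∑ i ∈ range n, if x i ≤ z then x i / y i else 0 with hB
  have hA0 : 0 < A := by
    obtain ⟨i, hi, hiz⟩ := hex
    refine sum_pos' (fun j hj => ?_) ⟨i, mem_range.2 hi, ?_⟩
    · have := hy j (mem_range.1 hj)
      split_ifs <;> positivity
    · have := hy i hi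
      rw [if_pos hiz]
      positivity
  have hlin : ∀ c, z ≤ c → (∀ i < n, z < x i → c ≤ x i) → mass x y n c = A * c - B := by
    intro c hc hc'
    rw [hA, hB, mass, sum_mul, ← sum_sub_distrib]
    refine sum_congr rfl fun i hi => ?_
    have hi' := mem_range.1 hi
    have := hy i hi'
    split_ifs with h
    · rw [max_eq_right (div_nonneg (by linarith) this.le)]
      ring
    · rw [max_eq_left (div_nonpos_of_nonpos_of_nonneg
        (by linarith [hc' i hi' (not_le.1 h)]) this.le)]
      ring
  have hAτ : A * τ - B = K := by
    rw [hτ]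
    field_simp
    ring
  have hzτ : z ≤ τ := by
    rw [hlin z le_rfl fun i _ h => h.le] at hz
    exact le_of_mul_le_mul_left (by linarith) hA0
  refine ⟨?_, hzτ⟩
  rw [hlin τ hzτ, hAτ]
  intro i hi hzi
  obtain ⟨j, hj, hmin⟩ := exists_min_image {i ∈ range n | z < x i} x
    ⟨i, mem_filter.2 ⟨mem_range.2 hi, hzi⟩⟩
  rw [mem_filter, mem_range] at hj
  have hjm : K < mass x y n (x j) := not_le.1 fun h => (hmax j hj.1 h).not_gt hj.2
  rw [hlin (x j) hj.2.le fun i hi h => hmin i (mem_filter.2 ⟨mem_range.2 hi, h⟩)] at hjm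
  have : τ < x j := lt_of_mul_lt_mul_left (by linarith) hA0.le
  exact this.le.trans (hmin i (mem_filter.2 ⟨mem_range.2 hi, hzi⟩))

theorem sum_numLT_lt (hn : 0 < n) {k : ℕ} (hk : 0 < k) {τ : ℝ}
    (hτ : mass x y n τ = max 0 ((k : ℝ) - n)) : ∑ i ∈ range n, numLT (x i) (y i) τ < k := by
  rcases le_or_gt k n with h | h
  · have h' : (k : ℝ) ≤ n := by exact_mod_cast h
    rw [max_eq_left (by linarith)] at hτ
    have h0 := (sum_eq_zero_iff_of_nonneg fun i _ => le_max_left _ _).1 hτ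
    rw [sum_eq_zero]
    · exact hk
    · intro i hi
      exact Nat.ceil_eq_zero.2 (max_eq_left_iff.1 (h0 i hi))
  · have h' : (n : ℝ) < k := by exact_mod_cast h
    rw [max_eq_right (by linarith)] at hτ
    have : ∑ i ∈ range n, (numLT (x i) (y i) τ : ℝ) <
        ∑ i ∈ range n, (max 0 ((τ - x i) / y i) + 1) :=
      sum_lt_sum_of_nonempty ⟨0, mem_range.2 hn⟩ fun i _ => numLT_lt
    rw [sum_add_distrib, ← mass, hτ] at this
    simp only [sum_const, card_range, nsmul_eq_mul, mul_one, sub_add_cancel] at this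
    exact_mod_cast this

theorem le_sum_numLE (hy : ∀ i < n, 0 < y i) {k : ℕ} {τ : ℝ} (hτ : mass x y n τ = k) :
    k ≤ ∑ i ∈ range n, numLE (x i) (y i) τ := by
  have : mass x y n τ ≤ ∑ i ∈ range n, (numLE (x i) (y i) τ : ℝ) :=
    sum_le_sum fun i hi => le_numLE (hy i (mem_range.1 hi))
  rw [hτ] at this
  exact_mod_cast this

theorem sum_numLE_le_add (hy : ∀ i < n, 0 < y i) {k : ℕ} {τ τ' : ℝ}
    (hτ' : mass x y n τ' = max 0 ((k : ℝ) - n)) (hτ : mass x y n τ = k) :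
    ∑ i ∈ range n, numLE (x i) (y i) τ ≤ ∑ i ∈ range n, numLT (x i) (y i) τ' + 2 * n := by
  have h1 : ∑ i ∈ range n, (numLE (x i) (y i) τ : ℝ) ≤
      ∑ i ∈ range n, (max 0 ((τ - x i) / y i) + 1) :=
    sum_le_sum fun i hi => numLE_le (hy i (mem_range.1 hi))
  have h2 : mass x y n τ' ≤ ∑ i ∈ range n, (numLT (x i) (y i) τ' : ℝ) :=
    sum_le_sum fun i _ => le_numLT
  rw [sum_add_distrib, ← mass, hτ] at h1
  rw [hτ'] at h2
  simp only [sum_const, card_range, nsmul_eq_mul, mul_one] at h1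
  have h3 : ∑ i ∈ range n, (numLE (x i) (y i) τ : ℝ) ≤
      ∑ i ∈ range n, (numLT (x i) (y i) τ' : ℝ) + 2 * n := by
    linarith [le_max_right 0 ((k : ℝ) - n)]
  exact_mod_cast h3

/-- The terms between `τ'` and `τ` of the progressions `x i + y i * j` for `i < n`. -/
noncomputable def candidates (x y : ℕ → ℝ) (τ' τ : ℝ) (n : ℕ) : List ℝ :=
  (List.range n).flatMap fun i =>
    (List.range' (numLT (x i) (y i) τ') (numLE (x i) (y i) τ - numLT (x i) (y i) τ')).map
      fun j : ℕ => x i + y i * (j : ℝ)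

theorem countP_lt_range' (a m b : ℕ) :
    (List.range' a m).countP (fun j => j < b) = min (b - a) m := by
  induction m generalizing a with
  | zero => simp
  | succ m ih =>
    rw [List.range'_succ, List.countP_cons, ih]
    by_cases h : a < b
    · simp [h]
      omega
    · simp [h]
      omega

theorem countP_candidates {q : ℝ → Prop} [DecidablePred q] {B : ℕ → ℕ} {τ' τ : ℝ}
    (hq : ∀ i < n, ∀ j : ℕ, q (x i + y i * j) ↔ j < B i)
    (hB : ∀ i < n, numLT (x i) (y i) τ' ≤ B i ∧ B i ≤ numLE (x i) (y i) τ) :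
    (candidates x y τ' τ n).countP q + ∑ i ∈ range n, numLT (x i) (y i) τ' =
      ∑ i ∈ range n, B i := by
  unfold candidates
  induction n with
  | zero => simp
  | succ n ih =>
    rw [List.range_succ, List.flatMap_append, List.countP_append, sum_range_succ, sum_range_succ,
      ← ih (fun i hi => hq i (by omega)) (fun i hi => hB i (by omega))]
    have h1 := hB n n.lt_succ_self
    have h2 : ((List.range' (numLT (x n) (y n) τ')
        (numLE (x n) (y n) τ - numLT (x n) (y n) τ')).map
          fun j : ℕ => x n + y n * (j : ℝ)).countP q = B n - numLT (x n) (y n) τ' := by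
      rw [List.countP_map]
      have : ((fun b => decide (q b)) ∘ fun j : ℕ => x n + y n * (j : ℝ)) =
          fun j => decide (j < B n) := by
        funext j
        simp [hq n n.lt_succ_self]
      rw [this, countP_lt_range']
      omega
    simp only [List.flatMap_cons, List.flatMap_nil, List.append_nil]
    omega

theorem mem_candidates (hy : ∀ i < n, 0 < y i) {τ' τ v : ℝ} (hv : v ∈ candidates x y τ' τ n) :
    τ' ≤ v ∧ v ≤ τ := by
  simp only [candidates, List.mem_flatMap, List.mem_range, List.mem_map, List.mem_range'_1] at hv
  obtain ⟨i, hi, j, ⟨hj, hj'⟩, rfl⟩ := hv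
  have h1 := mt (lt_numLT_iff (hy i hi)).2 hj.not_gt
  exact ⟨not_lt.1 h1, (lt_numLE_iff (hy i hi)).1 (by omega)⟩

theorem load_map_pair (l : List ℝ) (c : ℝ) :
    load (l.map fun v => (v, 0, 1)) c = l.countP fun v => v < c := by
  unfold load
  induction l with
  | nil => simp
  | cons v l ih =>
    rw [List.countP_cons]
    push_cast
    rw [← ih]
    simp
    ring

/-- What the final search among the candidates finds is a `k`-th smallest term. -/
theorem kth_of_search (hy : ∀ i < n, 0 < y i) {k : ℕ} {τ' τ c : ℝ} (hττ : τ' ≤ τ)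
    (hL : ∑ i ∈ range n, numLT (x i) (y i) τ' < k)
    (hU : k ≤ ∑ i ∈ range n, numLE (x i) (y i) τ)
    (hc : (candidates x y τ' τ n).countP (fun v => v < c) +
      ∑ i ∈ range n, numLT (x i) (y i) τ' < k)
    (hmax : ∀ v ∈ candidates x y τ' τ n, (candidates x y τ' τ n).countP (fun w => w < v) +
      ∑ i ∈ range n, numLT (x i) (y i) τ' < k → v ≤ c) :
    ∑ i ∈ range n, numLT (x i) (y i) c < k ∧ k ≤ ∑ i ∈ range n, numLE (x i) (y i) c := by
  set l := candidates x y τ' τ n with hl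
  have hle : ∀ c, τ' ≤ c → c ≤ τ → l.countP (fun v => v ≤ c) +
      ∑ i ∈ range n, numLT (x i) (y i) τ' = ∑ i ∈ range n, numLE (x i) (y i) c :=
    fun c h1 h2 => countP_candidates (fun i hi j => (lt_numLE_iff (hy i hi)).symm) fun i hi =>
      ⟨numLT_le_numLE (hy i hi) h1, le_of_forall_lt fun j hj =>
        (lt_numLE_iff (hy i hi)).2 (((lt_numLE_iff (hy i hi)).1 hj).trans h2)⟩
  have hτ := hle τ hττ le_rfl
  have hmin : ∀ q : ℝ → Prop, (∃ v ∈ l, q v) → ∃ v ∈ l, q v ∧ ∀ w ∈ l, q w → v ≤ w := by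
    classical
    rintro q ⟨v, hv, hqv⟩
    obtain ⟨d, hd, hd'⟩ := exists_min_image {v ∈ l.toFinset | q v} id ⟨v, by simp [hv, hqv]⟩
    simp only [mem_filter, List.mem_toFinset, id] at hd hd'
    exact ⟨d, hd.1, hd.2, fun w hw hqw => hd' w ⟨hw, hqw⟩⟩
  have hτ'c : τ' ≤ c := by
    obtain ⟨v, hv, -⟩ := List.countP_pos_iff.1 (show 0 < l.countP fun v => v ≤ τ by omega)
    obtain ⟨d, hd, -, hd'⟩ := hmin (fun _ => True) ⟨v, hv, trivial⟩
    have h0 : l.countP (fun w => w < d) = 0 :=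
      List.countP_eq_zero.2 fun w hw => by simpa using hd' w hw trivial
    exact (mem_candidates hy hd).1.trans (hmax d hd (by omega))
  have hcτ : c ≤ τ := by
    by_contra! h
    have : l.countP (fun v => v ≤ τ) ≤ l.countP (fun v => v < c) :=
      List.countP_mono_left fun v _ hv => by
        simp only [decide_eq_true_eq] at hv ⊢
        exact hv.trans_lt h
    omega
  have hlt : l.countP (fun v => v < c) + ∑ i ∈ range n, numLT (x i) (y i) τ' =
      ∑ i ∈ range n, numLT (x i) (y i) c :=
    countP_candidates (fun i hi j => (lt_numLT_iff (hy i hi)).symm) fun i hi =>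
      ⟨numLT_mono (hy i hi) hτ'c, numLT_le_numLE (hy i hi) hcτ⟩
  refine ⟨by omega, ?_⟩
  by_contra! h
  rw [← hle c hτ'c hcτ] at h
  obtain ⟨d, hd, hcd, hd'⟩ := hmin (fun v => c < v) <| by
    by_contra! hno
    have : l.countP (fun v => v ≤ τ) ≤ l.countP (fun v => v ≤ c) :=
      List.countP_mono_left fun v hv _ => by simpa using hno v hv
    omega
  have : l.countP (fun v => v < d) ≤ l.countP (fun v => v ≤ c) :=
    List.countP_mono_left fun v hv hvd => by
      simp only [decide_eq_true_eq] at hvd ⊢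
      exact not_lt.1 fun h => (hd' v hv h).not_gt hvd
  exact (hmax d hd (by omega)).not_gt hcd

end Progressions

/-! ### Selection in a union of arithmetic progressions -/

namespace RealRAM

open Finset

/-- Prepares the search among the starting points of the progressions in the arrays `0` and `1`. -/
def loadProgram : Program :=
  .nset 2 (.const 0) ;;
  .forLoop 2 0 (.rstore 2 (.reg 2) (.load 0 (.reg 2)) ;;
    .rstore 3 (.reg 2) (.div (.const 1) (.load 1 (.reg 2))) ;;
    .rstore 4 (.reg 2) (.sub (.const 0) (.div (.load 0 (.reg 2)) (.load 1 (.reg 2))))) ;;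
  .nset 1 (.reg 0)

theorem loadProgram_spec {s : State} {n : ℕ} {x y : ℕ → ℝ} (hn : s.nreg 0 = n)
    (hx : s.rarr 0 = x) (hy : s.rarr 1 = y) :
    Halts loadProgram s (n * 60 + 20) (fun s' => s'.nreg 1 = n ∧
      items s' n = (List.range n).map fun i => (x i, 1 / y i, 0 - x i / y i)) := by
  refine Halts.mono (Halts.exec_seq rfl <| Halts.seq (T' := 2)
    (Halts.forLoop_const (a := 0) (c := n)
      (fun i s' => items s' i = (List.range i).map fun i => (x i, 1 / y i, 0 - x i / y i))
      40 rfl rfl (by decide) ?_ ?_ n.zero_le ?_ ?_) ?_) ?_ fun _ h => h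
  · simp
  · simp [hn]
  · simp [items]
  · rintro i s' - hi hF hi2 h
    have e0 : s'.rarr 0 = x := by rw [hF.a 0 rfl]; simp [hx]
    have e1 : s'.rarr 1 = y := by rw [hF.a 1 rfl]; simp [hy]
    refine Halts.of_loopFree rfl (by decide) ?_
    rw [items_succ, List.range_succ, List.map_append, ← h]
    congr 1
    · refine items_congr ?_ ?_ ?_ <;> intro j hj <;> simp [hi2, Function.update_of_ne hj.ne]
    · simp [hi2, e0, e1]
  · intro s' hF h
    have e0 : s'.nreg 0 = n := by rw [hF.n 0 rfl]; simp [hn]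
    refine Halts.of_loopFree rfl le_rfl ⟨by simp [e0], ?_⟩
    exact h
  · simp
    omega

/-- Adds up what is needed to solve the linear equation for the mass, using the progressions that
start at or before `rreg 4`. -/
def linearProgram : Program :=
  (.nset 2 (.const 0) ;; .rset 7 (.const 0) ;; .rset 8 (.const 0)) ;;
  .forLoop 2 0 (.branch (.rle (.load 0 (.reg 2)) (.reg 4))
    (.rset 7 (.add (.reg 7) (.div (.const 1) (.load 1 (.reg 2)))) ;;
      .rset 8 (.add (.reg 8) (.div (.load 0 (.reg 2)) (.load 1 (.reg 2)))))
    .skip)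

theorem linearProgram_spec {s : State} {n : ℕ} {x y : ℕ → ℝ} {z : ℝ} (hn : s.nreg 0 = n)
    (hx : s.rarr 0 = x) (hy : s.rarr 1 = y) (hz : s.rreg 4 = z) :
    Halts linearProgram s (n * 60 + 20) (fun s' =>
      s'.rreg 7 = (∑ i ∈ range n, if x i ≤ z then 1 / y i else 0) ∧
      s'.rreg 8 = ∑ i ∈ range n, if x i ≤ z then x i / y i else 0) := by
  refine Halts.mono (Halts.exec_seq rfl <| Halts.forLoop_const (a := 0) (c := n) (fun i s' =>
      s'.rreg 7 = (∑ i ∈ range i, if x i ≤ z then 1 / y i else 0) ∧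
      s'.rreg 8 = ∑ i ∈ range i, if x i ≤ z then x i / y i else 0)
      40 rfl rfl (by decide) ?_ ?_ n.zero_le ?_ ?_) ?_ fun _ h => h
  · simp
  · simp [hn]
  · simp
  · rintro i s' - hi hF hi2 ⟨h7, h8⟩
    have e0 : s'.rarr 0 = x := by rw [hF.a 0 rfl]; simp [hx]
    have e1 : s'.rarr 1 = y := by rw [hF.a 1 rfl]; simp [hy]
    have e4 : s'.rreg 4 = z := by rw [hF.r 4 rfl]; simp [hz]
    refine Halts.of_loopFree rfl (by decide) ?_
    by_cases hc : x i ≤ z <;> simp [hi2, e0, e1, e4, hc, h7, h8, sum_range_succ]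
  · simp
    omega

/-- Leaves in `rreg 12` the point at which the progressions in the arrays `0` and `1` have the
mass `rreg 1`. -/
def solveProgram : Program :=
  loadProgram ;; searchProgram ;; linearProgram ;;
  .rset 12 (.div (.add (.reg 1) (.reg 8)) (.reg 7))

theorem solveProgram_spec {s : State} {n : ℕ} {x y : ℕ → ℝ} {K : ℝ} (hn : s.nreg 0 = n)
    (hx : s.rarr 0 = x) (hy : s.rarr 1 = y) (hK : s.rreg 1 = K) (hn0 : 0 < n)
    (hy0 : ∀ i < n, 0 < y i) (hK0 : 0 ≤ K) :
    Halts solveProgram s (n * 501000) (fun s' => mass x y n (s'.rreg 12) = K) := by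
  have hload : ∀ c, load ((List.range n).map fun i => (x i, 1 / y i, 0 - x i / y i)) c =
    mass x y n c := load_eq_mass hy0
  have hmono : Monotone (load ((List.range n).map fun i => (x i, 1 / y i, 0 - x i / y i))) := by
    rw [show load _ = mass x y n from funext hload]
    exact mass_mono hy0
  -- The first progression to start has mass zero at its starting point.
  obtain ⟨i₀, hi₀, hmin⟩ := exists_min_image (range n) x ⟨0, mem_range.2 hn0⟩
  rw [mem_range] at hi₀
  have hmass₀ : mass x y n (x i₀) ≤ K := by
    rw [mass, sum_eq_zero]
    · exact hK0
    · intro i hi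
      have := hy0 i (mem_range.1 hi)
      exact max_eq_left (div_nonpos_of_nonpos_of_nonneg (by linarith [hmin i hi]) this.le)
  refine Halts.mono (Halts.seq (T' := n * 500000 + 20 + (n * 60 + 20 + 20))
    (loadProgram_spec hn hx hy) fun s1 hF1 ⟨h1, hi1⟩ => Halts.seq
      (searchProgram_spec (K := K) h1 ?_ hi1 hmono ⟨_, List.mem_map.2 ⟨i₀, ?_, rfl⟩, ?_⟩)
      fun s2 hF2 h2 => Halts.seq (linearProgram_spec (n := n) (x := x) (y := y) ?_ ?_ ?_ rfl)
        fun s3 hF3 ⟨h7, h8⟩ => Halts.of_loopFree rfl (by decide) ?_) ?_ fun _ h => h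
  · rw [hF1.r 1 rfl, hK]
  · rwa [List.mem_range]
  · rwa [hload]
  · rw [hF2.n 0 rfl, hF1.n 0 rfl, hn]
  · rw [hF2.a 0 rfl, hF1.a 0 rfl, hx]
  · rw [hF2.a 1 rfl, hF1.a 1 rfl, hy]
  · have e1 : s3.rreg 1 = K := by rw [hF3.r 1 rfl, hF2.r 1 rfl, hF1.r 1 rfl, hK]
    have hmax : ∀ i < n, mass x y n (x i) ≤ K → x i ≤ s2.rreg 4 := fun i hi hle =>
      h2.2 _ (List.mem_map.2 ⟨i, List.mem_range.2 hi, rfl⟩) (by rwa [hload])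
    refine (mass_solution hy0 (z := s2.rreg 4) ?_ hmax ⟨i₀, hi₀, hmax i₀ hi₀ hmass₀⟩ ?_).1
    · rw [← hload]
      exact h2.1
    · simp [e1, h7, h8]
  · omega

/-- Collects in the arrays `2`, `3` and `4` the terms between `rreg 13` and `rreg 12` of the
progressions, as triples whose load is a counting function. The number of terms below `rreg 13`
is left in `rreg 14`. -/
def collectProgram : Program :=
  (.nset 2 (.const 0) ;; .nset 1 (.const 0) ;; .rset 14 (.const 0)) ;;
  .forLoop 2 0
    ((.rset 16 (.const 0) ;;
      .branch (.rle (.load 0 (.reg 2)) (.reg 13))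
        (.rset 16 (.sub (.const 0)
          (.floor (.div (.sub (.load 0 (.reg 2)) (.reg 13)) (.load 1 (.reg 2))))))
        .skip ;;
      .rset 14 (.add (.reg 14) (.reg 16))) ;;
    .loop (.rle (.add (.load 0 (.reg 2)) (.mul (.load 1 (.reg 2)) (.reg 16))) (.reg 12))
      (.rstore 2 (.reg 1) (.add (.load 0 (.reg 2)) (.mul (.load 1 (.reg 2)) (.reg 16))) ;;
        .rstore 3 (.reg 1) (.const 0) ;; .rstore 4 (.reg 1) (.const 1) ;;
        .nset 1 (.add (.reg 1) (.const 1)) ;; .rset 16 (.add (.reg 16) (.const 1))))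

/-- The machine has no ceiling; it uses `⌈z⌉ = -⌊-z⌋`. -/
theorem numLT_eq_sub_floor {x y τ : ℝ} (hy : 0 < y) :
    (numLT x y τ : ℝ) = if x ≤ τ then 0 - ((⌊(x - τ) / y⌋ : ℤ) : ℝ) else 0 := by
  unfold numLT
  split_ifs with h
  · have h0 : 0 ≤ ⌈(τ - x) / y⌉ := Int.ceil_nonneg (div_nonneg (by linarith) hy.le)
    rw [natCast_ceil_eq_intCast_ceil (div_nonneg (by linarith) hy.le), zero_sub, ← Int.cast_neg,
      ← Int.ceil_neg, ← neg_div, neg_sub]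
  · rw [Nat.ceil_eq_zero.2 (div_nonpos_of_nonpos_of_nonneg (by linarith) hy.le), Nat.cast_zero]

theorem candidates_succ (x y : ℕ → ℝ) (τ' τ : ℝ) (n : ℕ) :
    candidates x y τ' τ (n + 1) = candidates x y τ' τ n ++
      (List.range' (numLT (x n) (y n) τ') (numLE (x n) (y n) τ - numLT (x n) (y n) τ')).map
        fun j : ℕ => x n + y n * (j : ℝ) := by
  simp [candidates, List.range_succ]

theorem collectProgram_spec {s : State} {n : ℕ} {x y : ℕ → ℝ} {τ' τ : ℝ} (hn : s.nreg 0 = n)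
    (hx : s.rarr 0 = x) (hy : s.rarr 1 = y) (hτ' : s.rreg 13 = τ') (hτ : s.rreg 12 = τ)
    (hy0 : ∀ i < n, 0 < y i) (hττ : τ' ≤ τ) :
    Halts collectProgram s
      ((∑ i ∈ range n, (numLE (x i) (y i) τ - numLT (x i) (y i) τ')) * 60 + n * 80 + 20)
      (fun s' =>
        items s' (s'.nreg 1) = (candidates x y τ' τ n).map (fun v => (v, 0, 1)) ∧
        s'.rreg 14 = ((∑ i ∈ range n, numLT (x i) (y i) τ' : ℕ) : ℝ)) := by
  refine Halts.mono (Halts.exec_seq rfl <| Halts.forLoop (a := 0) (c := n) (fun i s' =>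
      items s' (s'.nreg 1) = (candidates x y τ' τ i).map (fun v => (v, 0, 1)) ∧
      s'.rreg 14 = ((∑ i ∈ range i, numLT (x i) (y i) τ' : ℕ) : ℝ))
      (fun i => (numLE (x i) (y i) τ - numLT (x i) (y i) τ') * 60 + 70)
      rfl rfl (by decide) ?_ ?_ n.zero_le ?_ ?_) ?_ fun _ h => h
  · simp
  · simp [hn]
  · simp [items, candidates]
  · rintro i s' - hi hF hi2 ⟨hit, h14⟩
    have e0 : s'.rarr 0 = x := by rw [hF.a 0 rfl]; simp [hx]
    have e1 : s'.rarr 1 = y := by rw [hF.a 1 rfl]; simp [hy]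
    have e12 : s'.rreg 12 = τ := by rw [hF.r 12 rfl]; simp [hτ]
    have e13 : s'.rreg 13 = τ' := by rw [hF.r 13 rfl]; simp [hτ']
    have hyi := hy0 i hi
    obtain ⟨L, hL⟩ : ∃ L, numLT (x i) (y i) τ' = L := ⟨_, rfl⟩
    obtain ⟨U, hU⟩ : ∃ U, numLE (x i) (y i) τ = U := ⟨_, rfl⟩
    have hLU : L ≤ U := by rw [← hL, ← hU]; exact numLT_le_numLE hyi hττ
    have hL' := numLT_eq_sub_floor (x := x i) (τ := τ') hyi
    obtain ⟨k, hk⟩ : ∃ k, s'.nreg 1 = k := ⟨_, rfl⟩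
    rw [hk] at hit
    set s1 := Program.exec s' (.rset 16 (.const 0) ;;
      .branch (.rle (.load 0 (.reg 2)) (.reg 13))
        (.rset 16 (.sub (.const 0)
          (.floor (.div (.sub (.load 0 (.reg 2)) (.reg 13)) (.load 1 (.reg 2))))))
        .skip ;;
      .rset 14 (.add (.reg 14) (.reg 16))) with hs1
    have hn1 : s1.nreg = s'.nreg := by
      by_cases hc : x i ≤ τ' <;> simp [hs1, hi2, e0, e13, hc]
    have ha1 : s1.rarr = s'.rarr := by
      by_cases hc : x i ≤ τ' <;> simp [hs1, hi2, e0, e13, hc]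
    have h16 : s1.rreg 16 = L := by
      rw [← hL, hL']
      by_cases hc : x i ≤ τ' <;> simp [hs1, hi2, e0, e1, e13, hc]
    have h141 : s1.rreg 14 = ((∑ i ∈ range (i + 1), numLT (x i) (y i) τ' : ℕ) : ℝ) := by
      rw [sum_range_succ, Nat.cast_add, ← h14, hL']
      by_cases hc : x i ≤ τ' <;> simp [hs1, hi2, e0, e1, e13, hc]
    have h12 : s1.rreg 12 = τ := by
      rw [← e12]
      by_cases hc : x i ≤ τ' <;> simp [hs1, hi2, e0, e13, hc]
    have hit1 : items s1 k = items s' k := by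
      refine items_congr ?_ ?_ ?_ <;> intro j _ <;> rw [ha1]
    rw [hL, hU]
    refine Halts.mono (Halts.exec_seq rfl <| Halts.frame <| Halts.loop (fun s2 => ∃ d, L + d ≤ U ∧
        s2.nreg 1 = k + d ∧ s2.rreg 16 = ((L + d : ℕ) : ℝ) ∧
        items s2 (k + d) = items s' k ++
          (List.range' L d).map fun j : ℕ => (x i + y i * (j : ℝ), 0, 1))
      (fun s2 => (k + (U - L) - s2.nreg 1) * 60) ?_ ?_) ?_ ?_
    · rw [← hs1]
      exact ⟨0, hLU, by rw [hn1, hk, Nat.add_zero], by simpa using h16, by simp [hit1]⟩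
    · rw [← hs1]
      rintro s2 hF2 ⟨d, hd, hd1, hd16, hdi⟩ hb
      have f2 : s2.nreg 2 = i := by rw [hF2.n 2 rfl, hn1, hi2]
      have f0 : s2.rarr 0 = x := by rw [hF2.a 0 rfl, ha1, e0]
      have f1 : s2.rarr 1 = y := by rw [hF2.a 1 rfl, ha1, e1]
      have f12 : s2.rreg 12 = τ := by rw [hF2.r 12 rfl, h12]
      simp only [Test.holds, RExpr.eval, NExpr.eval, f0, f1, f2, f12, hd16] at hb
      rw [← lt_numLE_iff hyi, hU] at hb
      refine ⟨_, Halts.of_loopFree rfl le_rfl ⟨⟨d + 1, hb, ?_, ?_, ?_⟩, ?_⟩⟩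
      · simp [hd1]
        omega
      · simp [hd16]
        ring
      · rw [← Nat.add_assoc, items_succ, List.range'_concat, List.map_append, ← List.append_assoc,
          ← hdi]
        congr 1
        · refine items_congr ?_ ?_ ?_ <;> intro j hj <;> simp [hd1, Function.update_of_ne hj.ne]
        · simp [hd1, hd16, f0, f1, f2]
      · simp [hd1]
        omega
    · rw [← hs1]
      simp [hn1, hk]
      omega
    · rw [← hs1]
      rintro s2 ⟨hF2, ⟨d, hd, hd1, hd16, hdi⟩, hb⟩
      have f2 : s2.nreg 2 = i := by rw [hF2.n 2 rfl, hn1, hi2]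
      have f0 : s2.rarr 0 = x := by rw [hF2.a 0 rfl, ha1, e0]
      have f1 : s2.rarr 1 = y := by rw [hF2.a 1 rfl, ha1, e1]
      have f12 : s2.rreg 12 = τ := by rw [hF2.r 12 rfl, h12]
      have f14 : s2.rreg 14 = s1.rreg 14 := hF2.r 14 rfl
      simp only [Test.holds, RExpr.eval, NExpr.eval, f0, f1, f2, f12, hd16] at hb
      rw [← lt_numLE_iff hyi, hU] at hb
      refine ⟨?_, by simpa [f14] using h141⟩
      rw [candidates_succ, hL, hU, List.map_append, ← hit, List.map_map, show U - L = d by omega]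
      simp only [Function.update_of_ne (show (1 : ℕ) ≠ 2 by decide), hd1]
      exact hdi
  · simp [sum_add_distrib, ← sum_mul]
    omega

/-- Leaves in `rreg 15` the real number with the value of `nreg 0`. There is no instruction for this
conversion, so it is done by counting. -/
def castProgram : Program :=
  (.nset 2 (.const 0) ;; .rset 15 (.const 0)) ;;
  .forLoop 2 0 (.rset 15 (.add (.reg 15) (.const 1)))

theorem castProgram_spec {s : State} {n : ℕ} (hn : s.nreg 0 = n) :
    Halts castProgram s (n * 20 + 10) (fun s' => s'.rreg 15 = n) := by
  refine Halts.mono (Halts.exec_seq rfl <| Halts.forLoop_const (a := 0) (c := n)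
    (fun i s' => s'.rreg 15 = i) 10 rfl rfl (by decide) (by simp) (by simp [hn]) n.zero_le
    (by simp) ?_) (by simp; omega) fun _ h => h
  rintro i s' - - - - h
  exact Halts.of_loopFree rfl (by decide) (by simp [h])

/-- Leaves in `rreg 0` the value of the `k`-th smallest term of the `n` progressions in the arrays `0`
and `1`, where `k` is in `rreg 0` and `n` in `nreg 0`. The points with the masses `max 0 (k - n)` and
`k` enclose the candidates. -/
def selectProgram : Program :=
  castProgram ;;
  .branch (.rle (.reg 0) (.reg 15)) (.rset 1 (.const 0)) (.rset 1 (.sub (.reg 0) (.reg 15))) ;;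
  solveProgram ;; (.rset 13 (.reg 12) ;; .rset 1 (.reg 0)) ;;
  solveProgram ;; collectProgram ;; .rset 1 (.sub (.sub (.reg 0) (.const 1)) (.reg 14)) ;;
  searchProgram ;; .rset 0 (.reg 4)

theorem selectProgram_spec {s : State} {n k : ℕ} {x y : ℕ → ℝ} (hn : s.nreg 0 = n)
    (hk : s.rreg 0 = k) (hx : s.rarr 0 = x) (hy : s.rarr 1 = y) (hn0 : 0 < n) (hk0 : 0 < k)
    (hy0 : ∀ i < n, 0 < y i) :
    Halts selectProgram s (n * 3000000) (fun s' =>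
      ∑ i ∈ range n, numLT (x i) (y i) (s'.rreg 0) < k ∧
      k ≤ ∑ i ∈ range n, numLE (x i) (y i) (s'.rreg 0)) := by
  refine Halts.mono (Halts.seq (T' := n * 2500000) (castProgram_spec hn) fun s1 hF1 h15 =>
    Halts.mono (Halts.exec_seq (T := n * 2400000) rfl ?_) ?_ fun _ h => h) ?_ fun _ h => h
  rotate_left
  · simp
    omega
  · omega
  have hn1 : s1.nreg 0 = n := by rw [hF1.n 0 rfl, hn]
  have hk1 : s1.rreg 0 = k := by rw [hF1.r 0 rfl, hk]
  have hx1 : s1.rarr 0 = x := by rw [hF1.a 0 rfl, hx]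
  have hy1 : s1.rarr 1 = y := by rw [hF1.a 1 rfl, hy]
  set s2 := Program.exec s1 (.branch (.rle (.reg 0) (.reg 15)) (.rset 1 (.const 0))
    (.rset 1 (.sub (.reg 0) (.reg 15)))) with hs2
  have hn2 : s2.nreg 0 = n := by
    by_cases hc : k ≤ n <;> simp [hs2, hk1, h15, hc, hn1]
  have hk2 : s2.rreg 0 = k := by
    by_cases hc : k ≤ n <;> simp [hs2, hk1, h15, hc]
  have ha2 : s2.rarr = s1.rarr := by
    by_cases hc : k ≤ n <;> simp [hs2, hk1, h15, hc]
  have hK2 : s2.rreg 1 = max 0 ((k : ℝ) - n) := by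
    by_cases hc : k ≤ n
    · have : (k : ℝ) ≤ n := by exact_mod_cast hc
      rw [max_eq_left (by linarith)]
      simp [hs2, hk1, h15, hc]
    · have : (n : ℝ) ≤ k := by exact_mod_cast (not_le.1 hc).le
      rw [max_eq_right (by linarith)]
      simp [hs2, hk1, h15, hc]
  have hx2 : s2.rarr 0 = x := by rw [ha2, hx1]
  have hy2 : s2.rarr 1 = y := by rw [ha2, hy1]
  refine Halts.mono (Halts.seq (T' := n * 1800000) (solveProgram_spec hn2 hx2 hy2 hK2 hn0 hy0
    (le_max_left _ _)) fun s3 hF3 hτ' => Halts.mono (Halts.exec_seq rfl <|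
      Halts.seq (T' := n * 1200000) (solveProgram_spec (n := n) (x := x) (y := y) (K := k)
        ?_ ?_ ?_ ?_ hn0 hy0 (Nat.cast_nonneg _)) fun s4 hF4 hτ => ?_) ?_ fun _ h => h)
    ?_ fun _ h => h
  · simp [hF3.n 0 rfl, hn2]
  · simp [hF3.a 0 rfl, hx2]
  · simp [hF3.a 1 rfl, hy2]
  · simp [hF3.r 0 rfl, hk2]
  · have hn4 : s4.nreg 0 = n := by rw [hF4.n 0 rfl]; simp [hF3.n 0 rfl, hn2]
    have hk4 : s4.rreg 0 = k := by rw [hF4.r 0 rfl]; simp [hF3.r 0 rfl, hk2]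
    have hx4 : s4.rarr 0 = x := by rw [hF4.a 0 rfl]; simp [hF3.a 0 rfl, hx2]
    have hy4 : s4.rarr 1 = y := by rw [hF4.a 1 rfl]; simp [hF3.a 1 rfl, hy2]
    have h13 : s4.rreg 13 = s3.rreg 12 := by rw [hF4.r 13 rfl]; simp
    obtain ⟨τ', hτ'e⟩ : ∃ τ', s3.rreg 12 = τ' := ⟨_, rfl⟩
    obtain ⟨τ, hτe⟩ : ∃ τ, s4.rreg 12 = τ := ⟨_, rfl⟩
    rw [hτ'e] at hτ' h13
    rw [hτe] at hτ
    have hkpos : (0 : ℝ) < k := by exact_mod_cast hk0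
    have hnpos : (0 : ℝ) < n := by exact_mod_cast hn0
    have hττ : τ' ≤ τ := by
      by_contra! h
      have := mass_mono (x := x) hy0 h.le
      rw [hτ, hτ'] at this
      exact this.not_gt (max_lt hkpos (by linarith))
    have hL := sum_numLT_lt hn0 hk0 hτ'
    have hU := le_sum_numLE hy0 hτ
    have hUL := sum_numLE_le_add hy0 hτ' hτ
    have hsub : ∑ i ∈ range n, (numLE (x i) (y i) τ - numLT (x i) (y i) τ') ≤ 2 * n := by
      rw [sum_tsub_distrib _ fun i hi => numLT_le_numLE (hy0 i (mem_range.1 hi)) hττ]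
      omega
    obtain ⟨l, hl⟩ : ∃ l, candidates x y τ' τ n = l := ⟨_, rfl⟩
    obtain ⟨N, hN⟩ : ∃ N, ∑ i ∈ range n, numLT (x i) (y i) τ' = N := ⟨_, rfl⟩
    have hlen : l.countP (fun v => v ≤ τ) + N = ∑ i ∈ range n, numLE (x i) (y i) τ := by
      rw [← hl, ← hN]
      exact countP_candidates (fun i hi j => (lt_numLE_iff (hy0 i hi)).symm) fun i hi =>
        ⟨numLT_le_numLE (hy0 i hi) hττ, le_rfl⟩
    have hlenEq : l.countP (fun v => v ≤ τ) = l.length := by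
      rw [List.countP_eq_length]
      intro v hv
      rw [← hl] at hv
      simpa using (mem_candidates hy0 hv).2
    have hload : ∀ c, load (l.map fun v => (v, 0, 1)) c ≤ (k : ℝ) - 1 - N ↔
        l.countP (fun v => v < c) + N < k := by
      intro c
      rw [load_map_pair, le_sub_iff_add_le, le_sub_iff_add_le]
      norm_cast
    have hmono : Monotone (load (l.map fun v => (v, 0, 1))) := by
      intro a b hab
      rw [load_map_pair, load_map_pair, Nat.cast_le]
      exact List.countP_mono_left fun v _ hv => by
        simp only [decide_eq_true_eq] at hv ⊢
        exact hv.trans_le hab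
    have hex : ∃ t ∈ l.map (fun v => (v, (0 : ℝ), (1 : ℝ))),
        load (l.map fun v => (v, 0, 1)) t.1 ≤ (k : ℝ) - 1 - N := by
      obtain ⟨v, hv⟩ : ∃ v, v ∈ l := List.exists_mem_of_length_pos (by omega)
      obtain ⟨d, hd, hmin⟩ := exists_min_image l.toFinset id ⟨v, by simpa using hv⟩
      simp only [List.mem_toFinset, id] at hd hmin
      refine ⟨_, List.mem_map.2 ⟨d, hd, rfl⟩, (hload _).2 ?_⟩
      rw [show l.countP (fun w => w < d) = 0 from
        List.countP_eq_zero.2 fun w hw => by simpa using hmin w hw]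
      omega
    refine Halts.mono (Halts.seq (T' := n * 1100000)
      (collectProgram_spec hn4 hx4 hy4 h13 hτe hy0 hττ) fun s5 hF5 ⟨hit, h14⟩ =>
      Halts.mono (Halts.exec_seq rfl <| Halts.seq (T' := 2)
        (searchProgram_spec (m := l.length) (K := (k : ℝ) - 1 - N)
          (l := l.map fun v => (v, 0, 1)) ?_ ?_ ?_ hmono hex)
        fun s6 hF6 hbest => Halts.of_loopFree rfl le_rfl ?_) ?_ fun _ h => h) ?_ fun _ h => h
    · have := congrArg List.length hit
      rw [length_items, List.length_map, hl] at this
      simpa using this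
    · simp [hF5.r 0 rfl, hk4, h14, hN]
    · rw [← hl, ← hit]
      have := congrArg List.length hit
      rw [length_items, List.length_map] at this
      rw [← this]
      rfl
    · simp only [Program.exec, RExpr.eval, Function.update_self]
      refine kth_of_search hy0 hττ hL hU ?_ fun v hv hlt => ?_
      · rw [hN, hl]
        exact (hload _).1 hbest.1
      · rw [hl] at hv hlt
        rw [hN] at hlt
        exact hbest.2 _ (List.mem_map.2 ⟨v, hv, rfl⟩) ((hload _).2 hlt)
    · simp
      omega
    · omega
  · simp
    omega
  · omega

end RealRAM

section KthSmallest

open Finset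

theorem isKthSmallest_disjointUnion {n k : ℕ} {𝒜 : Fin n → ℕ → ℝ} {x y : Fin n → ℝ} {τ : ℝ}
    (hy : ∀ i, 0 < y i) (h𝒜 : ∀ i j, 𝒜 i j = x i + y i * (j : ℝ))
    (hlt : ∑ i, numLT (x i) (y i) τ < k) (hle : k ≤ ∑ i, numLE (x i) (y i) τ) :
    IsKthSmallest (disjointUnion 𝒜) k τ := by
  obtain ⟨T, hT, hTc⟩ : ∃ T : Finset (Fin n × ℕ), (∀ p, p ∈ T ↔ disjointUnion 𝒜 p < τ) ∧
      #T = ∑ i, numLT (x i) (y i) τ := by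
    refine ⟨(univ.sigma fun i => range (numLT (x i) (y i) τ)).map
      (Equiv.sigmaEquivProd _ _).toEmbedding, fun p => ?_, by simp⟩
    simp [disjointUnion, h𝒜, lt_numLT_iff (hy _), Equiv.sigmaEquivProd]
  obtain ⟨T', hT', hTc'⟩ : ∃ T : Finset (Fin n × ℕ), (∀ p, p ∈ T ↔ disjointUnion 𝒜 p ≤ τ) ∧
      #T = ∑ i, numLE (x i) (y i) τ := by
    refine ⟨(univ.sigma fun i => range (numLE (x i) (y i) τ)).map
      (Equiv.sigmaEquivProd _ _).toEmbedding, fun p => ?_, by simp⟩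
    simp [disjointUnion, h𝒜, lt_numLE_iff (hy _), Equiv.sigmaEquivProd]
  obtain ⟨S, hTS, hST, hS⟩ := exists_subsuperset_card_eq (s := T) (t := T') (n := k)
    (fun p hp => (hT' p).2 ((hT p).1 hp).le) (by omega) (by omega)
  refine ⟨S, hS, ?_, fun p hp => (hT' p).1 (hST hp), fun p hp => not_lt.1 fun h =>
    hp (hTS ((hT p).2 h))⟩
  by_contra! hne
  have : S ⊆ T := fun p hp => (hT p).2 (((hT' p).1 (hST hp)).lt_of_ne (hne p hp))
  have := card_le_card this
  omega

end KthSmallest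

/-! ### Highest averages methods -/

section HighestAverages

open Finset

theorem priority_le_of_div_le {v v' d d' : ℝ} (hd : d ≠ 0) (hd' : d' ≠ 0) (h : v / d ≤ v' / d') :
    priority v d ≤ priority v' d' := by
  rw [priority, priority, if_neg hd, if_neg hd', Prod.Lex.toLex_le_toLex]
  rcases h.lt_or_eq with h | h
  · exact .inl (by simpa using h)
  · exact .inr ⟨by simp [h], le_rfl⟩

theorem priority_le_zero {v v' d : ℝ} (hd : d ≠ 0) : priority v d ≤ priority v' 0 := by
  rw [priority, priority, if_neg hd, if_pos rfl, Prod.Lex.toLex_le_toLex]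
  exact .inl (WithTop.coe_lt_top _)

theorem priority_zero_le_zero {v v' : ℝ} (h : v ≤ v') : priority v 0 ≤ priority v' 0 := by
  rw [priority, priority, if_pos rfl, if_pos rfl, Prod.Lex.toLex_le_toLex]
  exact .inr ⟨rfl, h⟩

theorem priority_antitone {v d₀ δ : ℝ} {d : ℕ → ℝ} (hv : 0 < v) (hd₀ : 0 ≤ d₀) (hδ : 0 < δ)
    (hd : ∀ j, d j = d₀ + δ * (j : ℝ)) : Antitone fun j => priority v (d j) := by
  intro j j' hjj
  have hj0 : 0 ≤ d j := by rw [hd]; positivity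
  have hle : d j ≤ d j' := by
    rw [hd, hd]
    gcongr
  change priority v (d j') ≤ priority v (d j)
  rcases hj0.eq_or_lt with h | h
  · rw [← h]
    rcases eq_or_ne (d j') 0 with h' | h'
    · rw [h']
    · exact priority_le_zero h'
  · exact priority_le_of_div_le (h.trans_le hle).ne' h.ne' (by gcongr)

/-- An allocation is a possible outcome if no entity would now be served before a unit that was
handed out. Taking back a unit that was handed out at the lowest priority gives the last step. -/
theorem highestAverages_of_priority_le {n : ℕ} {d : ℕ → ℝ} {v : Fin n → ℝ}
    (hanti : ∀ i, Antitone fun j => priority (v i) (d j)) (k : ℕ) (a : Fin n → ℕ)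
    (hsum : ∑ i, a i = k)
    (h : ∀ i i', 0 < a i → priority (v i') (d (a i')) ≤ priority (v i) (d (a i - 1))) :
    HighestAverages d v k a := by
  induction k generalizing a with
  | zero =>
    have : a = fun _ => 0 := funext fun i => (sum_eq_zero_iff.1 hsum) i (mem_univ i)
    rw [this]
    exact .start
  | succ k ih =>
    have hne : ({i | 0 < a i} : Finset (Fin n)).Nonempty := by
      by_contra hno
      rw [not_nonempty_iff_eq_empty, filter_eq_empty_iff] at hno
      have : ∑ i, a i = 0 := sum_eq_zero fun i hi => by simpa using hno hi
      omega
    obtain ⟨i, hi, hmin⟩ := exists_min_image _ (fun i => priority (v i) (d (a i - 1))) hne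
    simp only [mem_filter, mem_univ, true_and] at hi hmin
    obtain ⟨b, hb⟩ : ∃ b, b = Function.update a i (a i - 1) := ⟨_, rfl⟩
    have hbi : b i = a i - 1 := by rw [hb, Function.update_self]
    have hbj : ∀ j, j ≠ i → b j = a j := fun j hj => by rw [hb, Function.update_of_ne hj]
    have hab : a = Function.update b i (b i + 1) := by
      rw [hb, Function.update_idem, Function.update_self, Nat.sub_add_cancel hi,
        Function.update_eq_self]
    have hbsum : ∑ j, b j = k := by
      rw [hb, sum_update_of_mem (mem_univ i)]
      rw [← add_sum_erase univ a (mem_univ i), ← sdiff_singleton_eq_erase] at hsum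
      omega
    have hba : ∀ j, b j ≤ a j := fun j => by
      rcases eq_or_ne j i with rfl | hj
      · omega
      · exact (hbj j hj).le
    rw [hab]
    refine .give i (ih b hbsum fun p q hp => ?_) fun q => ?_
    · have hap : 0 < a p := lt_of_lt_of_le hp (hba p)
      have h1 : priority (v p) (d (a p - 1)) ≤ priority (v p) (d (b p - 1)) :=
        hanti p (Nat.sub_le_sub_right (hba p) 1)
      rcases eq_or_ne q i with rfl | hq
      · rw [hbi]
        exact (hmin p hap).trans h1
      · rw [hbj q hq]
        exact (h p q hap).trans h1
    · rw [hbi]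
      rcases eq_or_ne q i with rfl | hq
      · rw [hbi]
      · rw [hbj q hq]
        exact h i q hi

/-- The usual encoding: the priorities `v i / d j` are served in the order of the terms
`d j / v i`, as long as zero divisors do not decide the outcome. -/
theorem highestAverages_of_num {n k : ℕ} {d : ℕ → ℝ} {v : Fin n → ℝ} {d₀ δ τ : ℝ}
    {a : Fin n → ℕ} (hv : ∀ i, 0 < v i) (hd₀ : 0 ≤ d₀) (hδ : 0 < δ)
    (hd : ∀ j, d j = d₀ + δ * (j : ℝ)) (hsum : ∑ i, a i = k) (hkn : ¬ (d₀ ≤ 0 ∧ k ≤ n))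
    (hlt : ∀ i, numLT (d₀ / v i) (δ / v i) τ ≤ a i)
    (hle : ∀ i, a i ≤ numLE (d₀ / v i) (δ / v i) τ) : HighestAverages d v k a := by
  have hterm : ∀ i (j : ℕ), d₀ / v i + δ / v i * j = d j / v i := fun i j => by
    rw [hd]
    ring
  have hlt' : ∀ i, τ ≤ d (a i) / v i := fun i => by
    rw [← hterm]
    exact not_lt.1 (mt (lt_numLT_iff (div_pos hδ (hv i))).2 (hlt i).not_gt)
  have hle' : ∀ i, ∀ j < a i, d j / v i ≤ τ := fun i j hj => by
    rw [← hterm]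
    exact (lt_numLE_iff (div_pos hδ (hv i))).1 (hj.trans_le (hle i))
  have hd0 : ∀ j, 0 ≤ d j := fun j => by rw [hd]; positivity
  refine highestAverages_of_priority_le (fun i => priority_antitone (hv i) hd₀ hδ hd) k a hsum
    fun i i' hi => ?_
  have hcmp := (hle' i (a i - 1) (by omega)).trans (hlt' i')
  rcases (hd0 (a i - 1)).eq_or_lt with h0 | h0
  · rw [← h0]
    refine priority_le_zero fun h0' => hkn ?_
    have hd₀' : d₀ ≤ 0 := by
      have : 0 ≤ δ * (a i' : ℝ) := by positivity
      rw [hd] at h0'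
      linarith
    refine ⟨hd₀', ?_⟩
    have hτ : τ ≤ 0 := by simpa [h0'] using hlt' i'
    have hone : ∀ j, a j ≤ 1 := fun j => by
      by_contra! hj
      have h1 : d 1 / v j ≤ τ := hle' j 1 hj
      have h2 : 0 < d 1 / v j := by
        rw [hd]
        have := hv j
        positivity
      linarith
    rw [← hsum]
    calc ∑ i, a i ≤ ∑ _i : Fin n, 1 := sum_le_sum fun j _ => hone j
      _ = n := by simp
  · have h1 : 0 < d (a i') / v i' := (div_pos h0 (hv i)).trans_le hcmp
    have h2 : 0 < d (a i') := by
      by_contra! h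
      exact (div_nonpos_of_nonpos_of_nonneg h (hv i').le).not_gt h1
    refine priority_le_of_div_le h2.ne' h0.ne' ?_
    rw [div_le_div_iff₀ (hv i) (hv i')] at hcmp
    rw [div_le_div_iff₀ h2 h0]
    linarith

/-- If the first divisor is zero and there are no more units than entities, then the units go to
the entities with the highest scores, which the progressions `-v i + v i * j` express. -/
theorem highestAverages_of_num_neg {n k : ℕ} {d : ℕ → ℝ} {v : Fin n → ℝ} {d₀ δ τ : ℝ}
    {a : Fin n → ℕ} (hv : ∀ i, 0 < v i) (hd₀ : 0 ≤ d₀) (hδ : 0 < δ)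
    (hd : ∀ j, d j = d₀ + δ * (j : ℝ)) (hsum : ∑ i, a i = k) (hkn : d₀ ≤ 0 ∧ k ≤ n)
    (hk : ∑ i, numLT (-v i) (v i) τ < k)
    (hlt : ∀ i, numLT (-v i) (v i) τ ≤ a i) (hle : ∀ i, a i ≤ numLE (-v i) (v i) τ) :
    HighestAverages d v k a := by
  have hτ : τ < 0 := by
    by_contra! hτ
    have : ∑ _i : Fin n, 1 ≤ ∑ i, numLT (-v i) (v i) τ := sum_le_sum fun i _ =>
      (lt_numLT_iff (j := 0) (hv i)).2 (by have := hv i; simp; linarith)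
    simp at this
    omega
  have hd₀' : d₀ = 0 := le_antisymm hkn.1 hd₀
  have hd0 : d 0 = 0 := by simp [hd, hd₀']
  refine highestAverages_of_priority_le (fun i => priority_antitone (hv i) hd₀ hδ hd) k a hsum
    fun i i' hi => ?_
  have h1 : -v i + v i * ((a i - 1 : ℕ) : ℝ) ≤ τ :=
    (lt_numLE_iff (hv i)).1 (lt_of_lt_of_le (by omega) (hle i))
  have hai : a i - 1 = 0 := by
    by_contra h0
    have : (1 : ℝ) ≤ ((a i - 1 : ℕ) : ℝ) := by exact_mod_cast Nat.one_le_iff_ne_zero.2 h0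
    nlinarith [hv i]
  rw [hai] at h1 ⊢
  rw [hd0]
  rcases Nat.eq_zero_or_pos (a i') with h0 | h0
  · have h2 := not_lt.1 (mt (lt_numLT_iff (hv i')).2 (hlt i').not_gt)
    rw [h0] at h2 ⊢
    rw [hd0]
    simp at h1 h2
    exact priority_zero_le_zero (by linarith)
  · refine priority_le_zero ?_
    have : (0 : ℝ) < a i' := by exact_mod_cast h0
    rw [hd]
    positivity

end HighestAverages

namespace RealRAM

/-- Sets up the progressions for apportionment: for the score `v` it stores
`rreg 1 / v - rreg 20 * v` in array `0` and `rreg 2 / v + rreg 20 * v` in array `1`. -/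
def setupProgram : Program :=
  .nset 2 (.const 0) ;;
  .forLoop 2 0
    (.rstore 1 (.reg 2) (.add (.div (.reg 2) (.load 0 (.reg 2)))
      (.mul (.reg 20) (.load 0 (.reg 2)))) ;;
    .rstore 0 (.reg 2) (.sub (.div (.reg 1) (.load 0 (.reg 2)))
      (.mul (.reg 20) (.load 0 (.reg 2)))))

theorem setupProgram_spec {s : State} {n : ℕ} {v : ℕ → ℝ} {α β γ : ℝ} (hn : s.nreg 0 = n)
    (hv : s.rarr 0 = v) (hα : s.rreg 1 = α) (hβ : s.rreg 20 = β) (hγ : s.rreg 2 = γ) :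
    Halts setupProgram s (n * 60 + 20) (fun s' => ∀ i < n,
      s'.rarr 0 i = α / v i - β * v i ∧ s'.rarr 1 i = γ / v i + β * v i) := by
  refine Halts.mono (Halts.exec_seq rfl <| Halts.forLoop_const (a := 0) (c := n) (fun i s' =>
      (∀ j < i, s'.rarr 0 j = α / v j - β * v j ∧ s'.rarr 1 j = γ / v j + β * v j) ∧
      ∀ j, i ≤ j → s'.rarr 0 j = v j)
      40 rfl rfl (by decide) ?_ ?_ n.zero_le ?_ ?_) ?_ fun _ h => h.1
  · simp
  · simp [hn]
  · simp [hv]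
  · rintro i s' - hi hF hi2 ⟨h1, h2⟩
    have e1 : s'.rreg 1 = α := by rw [hF.r 1 rfl]; simp [hα]
    have e2 : s'.rreg 2 = γ := by rw [hF.r 2 rfl]; simp [hγ]
    have e20 : s'.rreg 20 = β := by rw [hF.r 20 rfl]; simp [hβ]
    have hvi := h2 i le_rfl
    refine Halts.of_loopFree rfl (by decide) ⟨fun j hj => ?_, fun j hj => ?_⟩
    · rcases Nat.lt_succ_iff_lt_or_eq.1 hj with hj | rfl
      · simpa [hi2, Function.update_of_ne hj.ne] using h1 j hj
      · simp [hi2, e1, e2, e20, hvi]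
    · simpa [hi2, Function.update_of_ne (show j ≠ i by omega)] using h2 j (by omega)
  · simp
    omega

/-- Puts the numbers of terms below `rreg 0` into array `5`, and what they leave of `rreg 17` into
`rreg 18`. -/
def floorProgram : Program :=
  (.nset 2 (.const 0) ;; .rset 18 (.reg 17)) ;;
  .forLoop 2 0
    (.branch (.rle (.load 0 (.reg 2)) (.reg 0))
      (.rstore 5 (.reg 2) (.sub (.const 0)
        (.floor (.div (.sub (.load 0 (.reg 2)) (.reg 0)) (.load 1 (.reg 2))))))
      (.rstore 5 (.reg 2) (.const 0)) ;;
    .rset 18 (.sub (.reg 18) (.load 5 (.reg 2))))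

theorem floorProgram_spec {s : State} {n : ℕ} {x y : ℕ → ℝ} {τ K : ℝ} (hn : s.nreg 0 = n)
    (hx : s.rarr 0 = x) (hy : s.rarr 1 = y) (hτ : s.rreg 0 = τ) (hK : s.rreg 17 = K)
    (hy0 : ∀ i < n, 0 < y i) :
    Halts floorProgram s (n * 60 + 20) (fun s' =>
      (∀ i < n, s'.rarr 5 i = numLT (x i) (y i) τ) ∧
      s'.rreg 18 = K - ((∑ i ∈ Finset.range n, numLT (x i) (y i) τ : ℕ) : ℝ)) := by
  refine Halts.mono (Halts.exec_seq rfl <| Halts.forLoop_const (a := 0) (c := n) (fun i s' =>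
      (∀ j < i, s'.rarr 5 j = numLT (x j) (y j) τ) ∧
      s'.rreg 18 = K - ((∑ i ∈ Finset.range i, numLT (x i) (y i) τ : ℕ) : ℝ))
      40 rfl rfl (by decide) ?_ ?_ n.zero_le ?_ ?_) ?_ fun _ h => h
  · simp
  · simp [hn]
  · simp [hK]
  · rintro i s' - hi hF hi2 ⟨h5, h18⟩
    have e0 : s'.rarr 0 = x := by rw [hF.a 0 rfl]; simp [hx]
    have e1 : s'.rarr 1 = y := by rw [hF.a 1 rfl]; simp [hy]
    have eτ : s'.rreg 0 = τ := by rw [hF.r 0 rfl]; simp [hτ]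
    have hL := numLT_eq_sub_floor (x := x i) (τ := τ) (hy0 i hi)
    refine Halts.of_loopFree rfl (by decide) ?_
    rw [Finset.sum_range_succ, Nat.cast_add]
    by_cases hc : x i ≤ τ
    · rw [if_pos hc] at hL
      refine ⟨fun j hj => ?_, ?_⟩
      · rcases Nat.lt_succ_iff_lt_or_eq.1 hj with hj | rfl
        · simpa [hi2, e0, e1, eτ, hc, Function.update_of_ne hj.ne] using h5 j hj
        · simp [hi2, e0, e1, eτ, hc, hL]
      · rw [hL]
        simp [hi2, e0, e1, eτ, hc, h18]
        ring
    · rw [if_neg hc] at hL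
      refine ⟨fun j hj => ?_, ?_⟩
      · rcases Nat.lt_succ_iff_lt_or_eq.1 hj with hj | rfl
        · simpa [hi2, e0, eτ, hc, Function.update_of_ne hj.ne] using h5 j hj
        · simp [hi2, e0, eτ, hc, hL]
      · rw [hL]
        simp [hi2, e0, eτ, hc, h18]
  · simp
    omega

/-- Copies the counts of array `5` to array `0`, and hands out `rreg 18` further units to entities
whose next term does not exceed `rreg 0`. -/
def tieProgram : Program :=
  .nset 2 (.const 0) ;;
  .forLoop 2 0
    (.branch (.and (.rle (.const 1) (.reg 18))
        (.rle (.add (.load 0 (.reg 2)) (.mul (.load 1 (.reg 2)) (.load 5 (.reg 2)))) (.reg 0)))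
      (.rstore 0 (.reg 2) (.add (.load 5 (.reg 2)) (.const 1)) ;;
        .rset 18 (.sub (.reg 18) (.const 1)))
      (.rstore 0 (.reg 2) (.load 5 (.reg 2))))

theorem tieProgram_spec {s : State} {n k : ℕ} {x y : ℕ → ℝ} {τ : ℝ} (hn : s.nreg 0 = n)
    (hx : s.rarr 0 = x) (hy : s.rarr 1 = y) (hτ : s.rreg 0 = τ) (hy0 : ∀ i < n, 0 < y i)
    (h5 : ∀ i < n, s.rarr 5 i = numLT (x i) (y i) τ)
    (h18 : s.rreg 18 = k - ((∑ i ∈ Finset.range n, numLT (x i) (y i) τ : ℕ) : ℝ))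
    (hlt : ∑ i ∈ Finset.range n, numLT (x i) (y i) τ ≤ k)
    (hle : k ≤ ∑ i ∈ Finset.range n, numLE (x i) (y i) τ) :
    Halts tieProgram s (n * 60 + 20) (fun s' => ∃ a : ℕ → ℕ, (∀ i < n, s'.rarr 0 i = a i) ∧
      (∀ i < n, numLT (x i) (y i) τ ≤ a i ∧ a i ≤ numLE (x i) (y i) τ) ∧
      ∑ i ∈ Finset.range n, a i = k) := by
  refine Halts.mono (Halts.exec_seq rfl <| Halts.forLoop_const (a := 0) (c := n) (fun i s' =>
      ∃ (a : ℕ → ℕ) (r : ℕ), (∀ j < i, s'.rarr 0 j = a j) ∧ (∀ j, i ≤ j → s'.rarr 0 j = x j) ∧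
      (∀ j < i, numLT (x j) (y j) τ ≤ a j ∧ a j ≤ numLE (x j) (y j) τ) ∧ s'.rreg 18 = r ∧
      r + ∑ j ∈ Finset.range i, a j + ∑ j ∈ Finset.Ico i n, numLT (x j) (y j) τ = k ∧
      k ≤ ∑ j ∈ Finset.range i, a j + ∑ j ∈ Finset.Ico i n, numLE (x j) (y j) τ)
      40 rfl rfl (by decide) ?_ ?_ n.zero_le ?_ ?_) ?_ ?_
  · simp
  · simp [hn]
  · refine ⟨fun _ => 0, k - ∑ i ∈ Finset.range n, numLT (x i) (y i) τ, by simp, by simp [hx],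
      by simp, ?_, ?_, ?_⟩
    · rw [Nat.cast_sub hlt, ← h18]
      simp
    · simp
      omega
    · simpa using hle
  · rintro i s' - hi hF hi2 ⟨a, r, ha, hax, hb, hr, hsum, hk⟩
    have e0 : s'.rarr 0 i = x i := hax i le_rfl
    have e1 : s'.rarr 1 = y := by rw [hF.a 1 rfl]; simp [hy]
    have e5 : s'.rarr 5 i = numLT (x i) (y i) τ := by rw [hF.a 5 rfl, ← h5 i hi]; simp
    have eτ : s'.rreg 0 = τ := by rw [hF.r 0 rfl]; simp [hτ]
    have hyi := hy0 i hi
    have hLU := numLT_le_numLE (x := x i) hyi (le_refl τ)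
    have hUL := numLE_le_numLT_add_one (x := x i) (τ := τ) hyi
    obtain ⟨L, hL⟩ : ∃ L, numLT (x i) (y i) τ = L := ⟨_, rfl⟩
    obtain ⟨U, hU⟩ : ∃ U, numLE (x i) (y i) τ = U := ⟨_, rfl⟩
    rw [Finset.sum_eq_sum_Ico_succ_bot hi, hL] at hsum
    rw [Finset.sum_eq_sum_Ico_succ_bot hi, hU] at hk
    have hiff := lt_numLE_iff (x := x i) (τ := τ) (j := L) hyi
    rw [hL] at e5 hLU hUL
    rw [hU] at hLU hUL hiff
    have hsa : ∀ c, ∑ j ∈ Finset.range (i + 1), Function.update a i c j =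
        ∑ j ∈ Finset.range i, a j + c := by
      intro c
      rw [Finset.sum_range_succ, Function.update_self]
      congr 1
      exact Finset.sum_congr rfl fun j hj => Function.update_of_ne (Finset.mem_range.1 hj).ne _ _
    refine Halts.of_loopFree rfl (by decide) ?_
    by_cases hc : 1 ≤ r ∧ x i + y i * L ≤ τ
    · have hc' : (1 : ℝ) ≤ r ∧ x i + y i * L ≤ τ := ⟨by exact_mod_cast hc.1, hc.2⟩
      refine ⟨Function.update a i (L + 1), r - 1, fun j hj => ?_, fun j hj => ?_, fun j hj => ?_,
        ?_, ?_, ?_⟩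
      · rcases Nat.lt_succ_iff_lt_or_eq.1 hj with hj | rfl
        · simp [hi2, e0, e1, e5, eτ, hr, hc', Function.update_of_ne hj.ne, ha j hj]
        · simp [hi2, e0, e1, e5, eτ, hr, hc']
      · simpa [hi2, e0, e1, e5, eτ, hr, hc', Function.update_of_ne (show j ≠ i by omega)] using
          hax j (by omega)
      · rcases Nat.lt_succ_iff_lt_or_eq.1 hj with hj | rfl
        · rw [Function.update_of_ne hj.ne]
          exact hb j hj
        · rw [Function.update_self, hL, hU]
          have := hiff.2 hc.2
          omega
      · simp [hi2, e0, e1, e5, eτ, hr, hc', Nat.cast_sub hc.1]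
      · rw [hsa]
        omega
      · rw [hsa]
        omega
    · have hc' : ¬ (((1 : ℕ) : ℝ) ≤ r ∧ x i + y i * L ≤ τ) := by
        rwa [Nat.cast_le]
      refine ⟨Function.update a i L, r, fun j hj => ?_, fun j hj => ?_, fun j hj => ?_,
        ?_, ?_, ?_⟩
      · simp only [Program.exec, Test.holds, RExpr.eval, NExpr.eval, hi2, e0, e1, e5, eτ, hr,
          if_neg hc']
        rcases Nat.lt_succ_iff_lt_or_eq.1 hj with hj | rfl
        · simp [Function.update_of_ne hj.ne, ha j hj]
        · simp
      · simp only [Program.exec, Test.holds, RExpr.eval, NExpr.eval, hi2, e0, e1, e5, eτ, hr,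
          if_neg hc']
        simpa [Function.update_of_ne (show j ≠ i by omega)] using hax j (by omega)
      · rcases Nat.lt_succ_iff_lt_or_eq.1 hj with hj | rfl
        · rw [Function.update_of_ne hj.ne]
          exact hb j hj
        · rw [Function.update_self, hL, hU]
          exact ⟨le_rfl, hLU⟩
      · simp only [Program.exec, Test.holds, RExpr.eval, NExpr.eval, hi2, e0, e1, e5, eτ, hr,
          if_neg hc']
      · rw [hsa]
        omega
      · rw [hsa]
        have hmono : ∑ j ∈ Finset.Ico (i + 1) n, numLT (x j) (y j) τ ≤
            ∑ j ∈ Finset.Ico (i + 1) n, numLE (x j) (y j) τ :=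
          Finset.sum_le_sum fun j hj => numLT_le_numLE (hy0 j (Finset.mem_Ico.1 hj).2) le_rfl
        rcases Nat.eq_zero_or_pos r with h0 | h0
        · omega
        · have := mt hiff.1 fun h => hc ⟨h0, h⟩
          omega
  · simp
    omega
  · -- The last two invariants leave no unit over.
    rintro s' ⟨a, r, ha, -, hb, -, hsum, hk⟩
    rw [Finset.Ico_self, Finset.sum_empty] at hsum hk
    exact ⟨a, ha, hb, by omega⟩

/-- Apportionment of `rreg 0` units by a highest averages method with the divisors
`rreg 1 + rreg 2 * j`. The branch tells apart the case that all units are handed out at infinite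
priority. -/
def apportionProgram : Program :=
  castProgram ;;
  (.rset 17 (.reg 0) ;;
    .branch (.and (.rle (.reg 1) (.const 0)) (.rle (.reg 0) (.reg 15)))
      (.rset 2 (.const 0) ;; .rset 20 (.const 1))
      (.rset 20 (.const 0))) ;;
  setupProgram ;; selectProgram ;; floorProgram ;; tieProgram

/-- The first condition on `x` and `y` is the case that all units are handed out at infinite
priority. -/
theorem apportionProgram_spec {s : State} {n k : ℕ} {v : ℕ → ℝ} {d₀ δ : ℝ} (hn : s.nreg 0 = n)
    (hk : s.rreg 0 = k) (hd₀ : s.rreg 1 = d₀) (hδ : s.rreg 2 = δ) (hv : s.rarr 0 = v)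
    (hn0 : 0 < n) (hk0 : 0 < k) (hv0 : ∀ i < n, 0 < v i) (hd₀0 : 0 ≤ d₀) (hδ0 : 0 < δ) :
    Halts apportionProgram s (n * 4000000) (fun s' => ∃ (x y : ℕ → ℝ) (τ : ℝ) (a : ℕ → ℕ),
      (d₀ ≤ 0 ∧ k ≤ n ∧ (∀ i < n, x i = -v i ∧ y i = v i) ∨
        ¬ (d₀ ≤ 0 ∧ k ≤ n) ∧ ∀ i < n, x i = d₀ / v i ∧ y i = δ / v i) ∧
      ∑ i ∈ Finset.range n, numLT (x i) (y i) τ < k ∧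
      (∀ i < n, s'.rarr 0 i = a i) ∧
      (∀ i < n, numLT (x i) (y i) τ ≤ a i ∧ a i ≤ numLE (x i) (y i) τ) ∧
      ∑ i ∈ Finset.range n, a i = k) := by
  refine Halts.mono (Halts.seq (T' := n * 3900000) (castProgram_spec hn) fun s1 hF1 h15 =>
    Halts.mono (Halts.exec_seq (T := n * 3800000) rfl ?_) ?_ fun _ h => h) ?_ fun _ h => h
  rotate_left
  · simp
    omega
  · omega
  have hn1 : s1.nreg 0 = n := by rw [hF1.n 0 rfl, hn]
  have hk1 : s1.rreg 0 = k := by rw [hF1.r 0 rfl, hk]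
  have hα1 : s1.rreg 1 = d₀ := by rw [hF1.r 1 rfl, hd₀]
  have hγ1 : s1.rreg 2 = δ := by rw [hF1.r 2 rfl, hδ]
  have hv1 : s1.rarr 0 = v := by rw [hF1.a 0 rfl, hv]
  set s2 := Program.exec s1 (.rset 17 (.reg 0) ;;
    .branch (.and (.rle (.reg 1) (.const 0)) (.rle (.reg 0) (.reg 15)))
      (.rset 2 (.const 0) ;; .rset 20 (.const 1))
      (.rset 20 (.const 0))) with hs2
  have hcond : s2.nreg = s1.nreg ∧ s2.rarr = s1.rarr ∧ s2.rreg 0 = k ∧ s2.rreg 17 = k ∧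
      s2.rreg 1 = d₀ ∧ (d₀ ≤ 0 ∧ k ≤ n ∧ s2.rreg 2 = 0 ∧ s2.rreg 20 = 1 ∨
        ¬ (d₀ ≤ 0 ∧ k ≤ n) ∧ s2.rreg 2 = δ ∧ s2.rreg 20 = 0) := by
    by_cases hc : d₀ ≤ 0 ∧ k ≤ n
    · simp [hs2, hk1, hα1, h15, hc]
    · have : Program.exec s1 (.rset 17 (.reg 0) ;;
          .branch (.and (.rle (.reg 1) (.const 0)) (.rle (.reg 0) (.reg 15)))
            (.rset 2 (.const 0) ;; .rset 20 (.const 1)) (.rset 20 (.const 0))) =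
          Program.exec s1 (.rset 17 (.reg 0) ;; .rset 20 (.const 0)) := by
        simp only [Program.exec]
        exact if_neg (by simpa [hk1, hα1, h15] using hc)
      rw [hs2, this]
      refine ⟨by simp, by simp, by simp [hk1], by simp [hk1], by simp [hα1], .inr ⟨hc, ?_, ?_⟩⟩
      · simp [hγ1]
      · simp
  obtain ⟨hn2, ha2, hk2, h17, h1, hdisj⟩ := hcond
  refine Halts.mono (Halts.seq (T' := n * 3500000) (setupProgram_spec (s := s2) (n := n) (v := v)
    (by rw [hn2, hn1]) (by rw [ha2, hv1]) h1 rfl rfl) fun s3 hF3 hxy => ?_) ?_ fun _ h => h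
  · obtain ⟨x, hx⟩ : ∃ x, s3.rarr 0 = x := ⟨_, rfl⟩
    obtain ⟨y, hy⟩ : ∃ y, s3.rarr 1 = y := ⟨_, rfl⟩
    rw [hx, hy] at hxy
    have hcases : d₀ ≤ 0 ∧ k ≤ n ∧ (∀ i < n, x i = -v i ∧ y i = v i) ∨
        ¬ (d₀ ≤ 0 ∧ k ≤ n) ∧ ∀ i < n, x i = d₀ / v i ∧ y i = δ / v i := by
      rcases hdisj with ⟨hc, hc', h2, h20⟩ | ⟨hc, h2, h20⟩
      · refine .inl ⟨hc, hc', fun i hi => ?_⟩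
        have := hxy i hi
        rw [h2, h20, le_antisymm hc hd₀0] at this
        simpa using this
      · refine .inr ⟨hc, fun i hi => ?_⟩
        have := hxy i hi
        rw [h2, h20] at this
        simpa using this
    have hy0 : ∀ i < n, 0 < y i := by
      intro i hi
      rcases hcases with ⟨-, -, h⟩ | ⟨-, h⟩
      · rw [(h i hi).2]
        exact hv0 i hi
      · rw [(h i hi).2]
        exact div_pos hδ0 (hv0 i hi)
    have hn3 : s3.nreg 0 = n := by rw [hF3.n 0 rfl, hn2, hn1]
    have hk3 : s3.rreg 0 = k := by rw [hF3.r 0 rfl, hk2]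
    refine Halts.mono (Halts.seq (T' := n * 60 + 20 + (n * 60 + 20))
      (selectProgram_spec hn3 hk3 hx hy hn0 hk0 hy0) fun s4 hF4 ⟨hlt, hle⟩ =>
      Halts.seq (floorProgram_spec (n := n) (x := x) (y := y) (K := k) ?_ ?_ ?_ rfl ?_ hy0)
        fun s5 hF5 ⟨h5, h18⟩ => Halts.mono (tieProgram_spec (n := n) (x := x) (y := y) ?_ ?_ ?_
          (hF5.r 0 rfl) hy0 h5 h18 hlt.le hle) le_rfl ?_) ?_ fun _ h => h
    · rw [hF4.n 0 rfl, hn3]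
    · rw [hF4.a 0 rfl, hx]
    · rw [hF4.a 1 rfl, hy]
    · rw [hF4.r 17 rfl, hF3.r 17 rfl, h17]
    · rw [hF5.n 0 rfl, hF4.n 0 rfl, hn3]
    · rw [hF5.a 0 rfl, hF4.a 0 rfl, hx]
    · rw [hF5.a 1 rfl, hF4.a 1 rfl, hy]
    · rintro s6 ⟨a, ha, hb, hsum⟩
      exact ⟨x, y, _, a, hcases, hlt, ha, hb, hsum⟩
    · omega
  · omega

end RealRAM

theorem theorem2 :
    (∃ (P : RealRAM.Program) (C : ℕ),
      ∀ (n : ℕ) (𝒜 : Fin n → ℕ → ℝ) (x y : Fin n → ℝ) (k : ℕ),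
        0 < n → 0 < k → (∀ i, 0 < y i) → (∀ i j, 𝒜 i j = x i + y i * (j : ℝ)) →
          ∃ (s : RealRAM.State) (t : ℕ),
            RealRAM.Runs P (RealRAM.selectionInput x y k) s t ∧ t ≤ C * n ∧
              IsKthSmallest (disjointUnion 𝒜) k (s.rreg 0)) ∧
    (∃ (P : RealRAM.Program) (C : ℕ),
      ∀ (n : ℕ) (v : Fin n → ℝ) (d : ℕ → ℝ) (d₀ δ : ℝ) (k : ℕ),
        0 < n → 0 < k → (∀ i, 0 < v i) → 0 ≤ d₀ → 0 < δ → (∀ j, d j = d₀ + δ * (j : ℝ)) →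
          ∃ (s : RealRAM.State) (t : ℕ) (a : Fin n → ℕ),
            RealRAM.Runs P (RealRAM.apportionmentInput v d₀ δ k) s t ∧ t ≤ C * n ∧
              HighestAverages d v k a ∧ ∀ i : Fin n, s.rarr 0 i = (a i : ℝ)) := by
  constructor
  · refine ⟨RealRAM.selectProgram, 3000000, fun n 𝒜 x y k hn hk hy h𝒜 => ?_⟩
    have hx' : ∀ i : Fin n, RealRAM.arrayOf x i = x i := fun i => by simp [RealRAM.arrayOf]
    have hy' : ∀ i : Fin n, RealRAM.arrayOf y i = y i := fun i => by simp [RealRAM.arrayOf]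
    obtain ⟨s, t, hr, ht, hlt, hle⟩ := RealRAM.selectProgram_spec
      (s := RealRAM.selectionInput x y k) (n := n) (k := k) (x := RealRAM.arrayOf x)
      (y := RealRAM.arrayOf y) rfl rfl rfl rfl hn hk fun i hi => by
        rw [hy' ⟨i, hi⟩]
        exact hy _
    refine ⟨s, t, hr, by omega, isKthSmallest_disjointUnion hy h𝒜 ?_ ?_⟩
    · rw [← Fin.sum_univ_eq_sum_range
        (fun i => numLT (RealRAM.arrayOf x i) (RealRAM.arrayOf y i) (s.rreg 0))] at hlt
      simpa only [hx', hy'] using hlt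
    · rw [← Fin.sum_univ_eq_sum_range
        (fun i => numLE (RealRAM.arrayOf x i) (RealRAM.arrayOf y i) (s.rreg 0))] at hle
      simpa only [hx', hy'] using hle
  · refine ⟨RealRAM.apportionProgram, 4000000, fun n v d d₀ δ k hn hk hv hd₀ hδ hd => ?_⟩
    have hv' : ∀ i : Fin n, RealRAM.arrayOf v i = v i := fun i => by simp [RealRAM.arrayOf]
    obtain ⟨s, t, hr, ht, x, y, τ, a, hcases, hlt, ha, hb, hsum⟩ :=
      RealRAM.apportionProgram_spec (s := RealRAM.apportionmentInput v d₀ δ k) (n := n) (k := k)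
        (v := RealRAM.arrayOf v) (d₀ := d₀) (δ := δ) rfl rfl rfl rfl rfl hn hk (fun i hi => by
          rw [hv' ⟨i, hi⟩]
          exact hv _) hd₀ hδ
    refine ⟨s, t, fun i => a i, hr, by omega, ?_, fun i => ha i i.isLt⟩
    rw [← Fin.sum_univ_eq_sum_range] at hsum
    rw [← Fin.sum_univ_eq_sum_range (fun i => numLT (x i) (y i) τ)] at hlt
    rcases hcases with ⟨h1, h2, hxy⟩ | ⟨h1, hxy⟩
    · have hx : ∀ i : Fin n, x i = -v i := fun i => by rw [(hxy i i.isLt).1, hv']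
      have hy : ∀ i : Fin n, y i = v i := fun i => by rw [(hxy i i.isLt).2, hv']
      simp only [hx, hy] at hlt
      exact highestAverages_of_num_neg hv hd₀ hδ hd hsum ⟨h1, h2⟩ hlt
        (fun i => by simpa only [hx, hy] using (hb i i.isLt).1)
        fun i => by simpa only [hx, hy] using (hb i i.isLt).2
    · have hx : ∀ i : Fin n, x i = d₀ / v i := fun i => by rw [(hxy i i.isLt).1, hv']
      have hy : ∀ i : Fin n, y i = δ / v i := fun i => by rw [(hxy i i.isLt).2, hv']
      exact highestAverages_of_num (τ := τ) hv hd₀ hδ hd hsum h1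
        (fun i => by simpa only [hx, hy] using (hb i i.isLt).1)
        fun i => by simpa only [hx, hy] using (hb i i.isLt).2
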